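/- Let $s_1,s_2>1$ and $p,q,r>0$ be fixed with $\frac1{s_1}+\frac1{s_2}<1$. For $a\ge 0$ let $$W_a(x)=\begin{cases} 1-\frac{2(s_1+pa)}{s_1-1+pa-2ra}\,x, & 0\le x<\frac12-\frac{\frac12+ra}{s_1+pa},\\ (s_1+pa)(x-\frac12)+\frac12+ra, & \frac12-\frac{\frac12+ra}{s_1+pa}\le x<\frac12,\\ -(s_2+qa)(x-\frac12)+\frac12+ra, & \frac12\le x<\frac12+\frac{\frac12+ra}{s_2+qa},\\ 1+\frac{2(s_2+qa)}{s_2-1+qa-2ra}(x-1), & \frac12+\frac{\frac12+ra}{s_2+qa}\le x\le 1.\end{cases}$$ Then there is $a_0>0$ (depending on $s_1,s_2,p,q,r$) such that for every $0\le a<a_0$ the map $W_a$ maps $[0,1]$ onto itself and has exactly one invariant probability measure $\mu_a$ that is absolutely continuous with respect to Lebesgue measure; let $h_a$ be the density of $\mu_a$. The densities are uniformly bounded: there is a constant $K$ with $h_a\le K$ almost everywhere on $[0,1]$ for all $0\le a<a_0$. The density of $\mu_0$ is $$h_0(x)=\begin{cases}\frac{2s_1(s_2+1)}{2s_1s_2+s_1-s_2},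 & 0\le x<\frac12,\\ \frac{2s_2(s_1-1)}{2s_1s_2+s_1-s_2}, & \frac12\le x\le 1.\end{cases}$$ Consequently, as $a\to0^+$, $h_a\to h_0$ in $L^1([0,1])$, and the measures $\mu_a$ converge $*$-weakly to $\mu_0$, that is, $\int\varphi\,d\mu_a\to\int\varphi\,d\mu_0$ for every continuous $\varphi:[0,1]\to\mathbb R$. -/

import Mathlib

open Set Filter Topology MeasureTheory

noncomputable section

namespace WMaps

/-- The `W`-shaped map `W_a` of `[0,1]` with parameters `s₁ s₂ p q r`
(only its values on `[0,1]` matter). -/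
def wMap (s₁ s₂ p q r a x : ℝ) : ℝ :=
  if x < 1 / 2 - (1 / 2 + r * a) / (s₁ + p * a) then
    1 - 2 * (s₁ + p * a) / (s₁ - 1 + p * a - 2 * r * a) * x
  else if x < 1 / 2 then
    (s₁ + p * a) * (x - 1 / 2) + 1 / 2 + r * a
  else if x < 1 / 2 + (1 / 2 + r * a) / (s₂ + q * a) then
    -(s₂ + q * a) * (x - 1 / 2) + 1 / 2 + r * a
  else
    1 + 2 * (s₂ + q * a) / (s₂ - 1 + q * a - 2 * r * a) * (x - 1)

/-- Lebesgue measure on `[0,1]`, as a measure on `ℝ`. -/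
def leb : Measure ℝ := volume.restrict (Icc (0 : ℝ) 1)

/-- `μ` is an absolutely continuous invariant probability measure (acim) of `T` on `[0,1]`. -/
def IsACIM (T : ℝ → ℝ) (μ : Measure ℝ) : Prop :=
  IsProbabilityMeasure μ ∧ μ ≪ leb ∧ MeasurePreserving T μ μ

/-- The measure on `[0,1]` with Lebesgue density `h`. -/
def densityMeasure (h : ℝ → ℝ) : Measure ℝ :=
  leb.withDensity fun x => ENNReal.ofReal (h x)

/-- `h` is a normalized invariant density of `T` on `[0,1]`:
a nonnegative function that is the Lebesgue density of an acim of `T`. -/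
def IsInvariantDensity (T : ℝ → ℝ) (h : ℝ → ℝ) : Prop :=
  AEMeasurable h leb ∧ (∀ᵐ x ∂leb, 0 ≤ h x) ∧ IsACIM T (densityMeasure h)

/-- The explicit normalized invariant density of the unperturbed map `W_0`. -/
def h₀ (s₁ s₂ x : ℝ) : ℝ :=
  if x < 1 / 2 then 2 * s₁ * (s₂ + 1) / (2 * s₁ * s₂ + s₁ - s₂)
  else 2 * s₂ * (s₁ - 1) / (2 * s₁ * s₂ + s₁ - s₂)

end WMaps

end

/-! ### The map in terms of slopes and overshoot -/

namespace WMaps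

/-! Everything rests on one change of variables, `integral_comp_slopeMap`. Write `W` for the map, `c
= 1/2 + e`, `θ = 1/u + 1/v`, `σ = invSlope`, and `G` for the primitive of `g` from `0`. Then the
primitive of `g ∘ W` at `t` is a constant multiple of `G 1`, plus `θ * G c` if `t ≥ 1/2`, plus `σ t
* G (W t)`. Since `|σ| ≤ ρ < 1`, this recursion can be iterated along orbits.

Uniqueness: for the indicator of an invariant set, the deviation of the primitive from a linear
function contracts under the recursion, hence vanishes. Invariant sets are therefore
Lebesgue-trivial, so an acim equivalent to Lebesgue measure is ergodic and is the only acim.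

Existence: let `c_n` be the orbit of `c` and `w_n` the product of the first `n` inverse slopes along
it. A combination of the constant `1` and the series of `w_n` times the indicator of `[0, c_n]` is
invariant, because the recursion shifts the series by one index (`integral_comp_mul_rawDensity`).

Uniformity: for small `e > 0` the orbit drops from the peak to the left of `1/2` and, because `1/s₁
+ 1/s₂ < 1`, stays there for any prescribed number of steps (`tendsto_peakOrbit_succ`). Visits to
the right half after time `0` thus have vanishing total weight, and the total absolute weight of all
later visits tends to `s₁ / (s₂ (s₁ - 1)) < 1`. This bounds the raw density below uniformly
(`exists_pos_le_rawDensity`); the geometric series bounds it above. Termwise limits identify the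
limit as a multiple of `h₀`, and dominated convergence gives convergence in `L¹`, hence weakly. -/

/-- Admissible slopes `u`, `v` and overshoot `e` of a `W`-shaped map with peak `1 / 2 + e`. -/
structure Admissible (u v e : ℝ) : Prop where
  nonneg : 0 ≤ e
  lt_half : e < 1 / 2
  left : 1 + 2 * e < u
  right : 1 + 2 * e < v

/-- The zero of the `W`-shaped map to the left of `1 / 2`. -/
noncomputable def leftZero (u e : ℝ) : ℝ := 1 / 2 - (1 / 2 + e) / u

/-- The zero of the `W`-shaped map to the right of `1 / 2`. -/
noncomputable def rightZero (v e : ℝ) : ℝ := 1 / 2 + (1 / 2 + e) / v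

/-- The `W`-shaped map with middle slopes `u`, `-v` and peak value `1 / 2 + e`. -/
noncomputable def slopeMap (u v e x : ℝ) : ℝ :=
  if x < leftZero u e then 1 - x / leftZero u e
  else if x < 1 / 2 then u * (x - 1 / 2) + (1 / 2 + e)
  else if x < rightZero v e then (1 / 2 + e) - v * (x - 1 / 2)
  else 1 + (x - 1) / (1 - rightZero v e)

/-- The reciprocal of the slope of the branch of `slopeMap` over `x`. -/
noncomputable def invSlope (u v e x : ℝ) : ℝ :=
  if x < leftZero u e then - leftZero u e
  else if x < 1 / 2 then 1 / u
  else if x < rightZero v e then - (1 / v)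
  else 1 - rightZero v e

namespace Admissible

variable {u v e : ℝ}

theorem u_pos (H : Admissible u v e) : 0 < u := by linarith [H.nonneg, H.left]

theorem v_pos (H : Admissible u v e) : 0 < v := by linarith [H.nonneg, H.right]

theorem leftZero_pos (H : Admissible u v e) : 0 < leftZero u e := by
  have h : (1 / 2 + e) / u < 1 / 2 := by
    rw [div_lt_iff₀ H.u_pos]; linarith [H.left]
  unfold leftZero; linarith

theorem leftZero_lt (H : Admissible u v e) : leftZero u e < 1 / 2 := by
  have h : 0 < (1 / 2 + e) / u := div_pos (by linarith [H.nonneg]) H.u_pos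
  unfold leftZero; linarith

theorem rightZero_lt (H : Admissible u v e) : rightZero v e < 1 := by
  have h : (1 / 2 + e) / v < 1 / 2 := by
    rw [div_lt_iff₀ H.v_pos]; linarith [H.right]
  unfold rightZero; linarith

theorem lt_rightZero (H : Admissible u v e) : 1 / 2 < rightZero v e := by
  have h : 0 < (1 / 2 + e) / v := div_pos (by linarith [H.nonneg]) H.v_pos
  unfold rightZero; linarith

theorem u_mul (H : Admissible u v e) : u * (1 / 2 - leftZero u e) = 1 / 2 + e := by
  have := H.u_pos.ne'
  unfold leftZero; field_simp; ring

theorem v_mul (H : Admissible u v e) : v * (rightZero v e - 1 / 2) = 1 / 2 + e := by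
  have := H.v_pos.ne'
  unfold rightZero; field_simp; ring

theorem peak_mem (H : Admissible u v e) : 1 / 2 + e ∈ Icc (0 : ℝ) 1 :=
  ⟨by linarith [H.nonneg], by linarith [H.lt_half]⟩

/-- Adjacent branches agree at the break points, so this and the next three branch formulas hold on
closed pieces, as integration over each piece requires. -/
theorem slopeMap_of_le_leftZero (H : Admissible u v e) {x : ℝ} (hx : x ≤ leftZero u e) :
    slopeMap u v e x = 1 - x / leftZero u e := by
  rcases hx.lt_or_eq with h | rfl
  · simp [slopeMap, h]
  · have h1 := H.leftZero_pos.ne'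
    have h2 := H.u_mul
    simp only [slopeMap, lt_irrefl, if_false, H.leftZero_lt, if_true, div_self h1]
    linarith

theorem slopeMap_of_mem_left (H : Admissible u v e) {x : ℝ} (hx : x ∈ Icc (leftZero u e) (1 / 2)) :
    slopeMap u v e x = u * x - u * leftZero u e := by
  have h2 := H.u_mul
  rcases hx.2.lt_or_eq with h | rfl
  · simp only [slopeMap, hx.1.not_gt, if_false, h, if_true]; linarith
  · simp only [slopeMap, H.leftZero_lt.not_gt, if_false, lt_irrefl, H.lt_rightZero, if_true]
    linarith

theorem slopeMap_of_mem_right (H : Admissible u v e) {x : ℝ}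
    (hx : x ∈ Icc (1 / 2) (rightZero v e)) :
    slopeMap u v e x = v * rightZero v e - v * x := by
  have h2 := H.v_mul
  have h1 : ¬ x < leftZero u e := by linarith [hx.1, H.leftZero_lt]
  have h3 : ¬ x < 1 / 2 := by linarith [hx.1]
  rcases hx.2.lt_or_eq with h | rfl
  · simp only [slopeMap, h1, if_false, h, h3, if_true]; linarith
  · have h4 : rightZero v e - 1 ≠ 0 := by linarith [H.rightZero_lt]
    have h5 : (rightZero v e - 1) / (1 - rightZero v e) = -1 := by
      rw [← neg_sub (rightZero v e) 1, div_neg, div_self h4]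
    simp only [slopeMap, h1, h3, if_false, lt_irrefl, h5]
    linarith

theorem slopeMap_of_rightZero_le (H : Admissible u v e) {x : ℝ} (hx : rightZero v e ≤ x) :
    slopeMap u v e x = 1 + (x - 1) / (1 - rightZero v e) := by
  have h1 : ¬ x < leftZero u e := by linarith [H.lt_rightZero, H.leftZero_lt]
  have h3 : ¬ x < 1 / 2 := by linarith [H.lt_rightZero]
  simp only [slopeMap, h1, h3, hx.not_gt, if_false]

theorem slopeMap_one (H : Admissible u v e) : slopeMap u v e 1 = 1 := by
  rw [H.slopeMap_of_rightZero_le H.rightZero_lt.le]; simp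

theorem slopeMap_mem (H : Admissible u v e) {x : ℝ} (hx : x ∈ Icc (0 : ℝ) 1) :
    slopeMap u v e x ∈ Icc (0 : ℝ) 1 := by
  have h0 := H.leftZero_pos
  have h1 := H.rightZero_lt
  have hp := H.peak_mem
  rcases le_total x (leftZero u e) with h | h
  · rw [H.slopeMap_of_le_leftZero h]
    have a := div_le_one_of_le₀ h h0.le
    have b := div_nonneg hx.1 h0.le
    constructor <;> linarith
  rcases le_total x (1 / 2) with h' | h'
  · rw [H.slopeMap_of_mem_left ⟨h, h'⟩]
    have a := mul_le_mul_of_nonneg_left h H.u_pos.le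
    have b := mul_le_mul_of_nonneg_left h' H.u_pos.le
    constructor <;> linarith [H.u_mul, hp.2]
  rcases le_total x (rightZero v e) with h2 | h2
  · rw [H.slopeMap_of_mem_right ⟨h', h2⟩]
    have a := mul_le_mul_of_nonneg_left h2 H.v_pos.le
    have b := mul_le_mul_of_nonneg_left h' H.v_pos.le
    constructor <;> linarith [H.v_mul, hp.2]
  · rw [H.slopeMap_of_rightZero_le h2]
    have a : (1 - x) / (1 - rightZero v e) ≤ 1 :=
      div_le_one_of_le₀ (by linarith) (by linarith)
    have b : 0 ≤ (1 - x) / (1 - rightZero v e) := div_nonneg (by linarith [hx.2]) (by linarith)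
    have c : (x - 1) / (1 - rightZero v e) = - ((1 - x) / (1 - rightZero v e)) := by
      rw [← neg_sub 1 x, neg_div]
    constructor <;> linarith

theorem image_slopeMap (H : Admissible u v e) :
    slopeMap u v e '' Icc (0 : ℝ) 1 = Icc (0 : ℝ) 1 := by
  apply Subset.antisymm
  · rintro _ ⟨x, hx, rfl⟩; exact H.slopeMap_mem hx
  · intro y hy
    have h0 := H.leftZero_pos
    have h1 := H.leftZero_lt
    have h : leftZero u e * (1 - y) ≤ leftZero u e := by nlinarith [hy.1]
    -- The leftmost branch alone is onto; this is its inverse at `y`.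
    refine ⟨leftZero u e * (1 - y), ⟨mul_nonneg h0.le (by linarith [hy.2]), by linarith⟩, ?_⟩
    rw [H.slopeMap_of_le_leftZero h, mul_div_cancel_left₀ _ h0.ne']; ring

theorem invSlope_one (H : Admissible u v e) : invSlope u v e 1 = 1 - rightZero v e := by
  have h1 := H.leftZero_lt
  have h2 := H.rightZero_lt
  simp only [invSlope]
  rw [if_neg (by linarith), if_neg (by linarith), if_neg (by linarith)]

/-- The outer branches map intervals shorter than `1/2` onto a unit interval, so their inverse
slopes are below `1/2`; only the middle slopes depend on finer data. -/
theorem abs_invSlope_le (H : Admissible u v e) {ρ : ℝ} (hρ : 1 / 2 ≤ ρ) (hu : 1 / u ≤ ρ)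
    (hv : 1 / v ≤ ρ) (x : ℝ) : |invSlope u v e x| ≤ ρ := by
  have h1 := H.leftZero_pos
  have h2 := H.leftZero_lt
  have h3 := H.rightZero_lt
  have h4 := H.lt_rightZero
  have h5 : 0 < 1 / u := one_div_pos.2 H.u_pos
  have h6 : 0 < 1 / v := one_div_pos.2 H.v_pos
  unfold invSlope
  split_ifs <;> rw [abs_le] <;> constructor <;> linarith

end Admissible

/-! ### Change of variables for primitives -/

theorem measurable_slopeMap (u v e : ℝ) : Measurable (slopeMap u v e) := by
  unfold slopeMap
  refine Measurable.ite measurableSet_Iio (by fun_prop) ?_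
  refine Measurable.ite measurableSet_Iio (by fun_prop) ?_
  exact Measurable.ite measurableSet_Iio (by fun_prop) (by fun_prop)

theorem intervalIntegrable_of_abs_le {g : ℝ → ℝ} (hg : Measurable g) {C : ℝ}
    (hC : ∀ x, |g x| ≤ C) (a b : ℝ) : IntervalIntegrable g volume a b := by
  rw [intervalIntegrable_iff]
  exact Measure.integrableOn_of_bounded (M := C) measure_Ioc_lt_top.ne hg.aestronglyMeasurable
    (Eventually.of_forall fun x => by simpa using hC x)

namespace Admissible

variable {u v e : ℝ}

/-- The primitive of `g ∘ slopeMap` in terms of the primitive of `g`. -/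
theorem integral_comp_slopeMap (H : Admissible u v e) {g : ℝ → ℝ} (hg : Measurable g) {C : ℝ}
    (hC : ∀ x, |g x| ≤ C) {t : ℝ} (ht : t ∈ Icc (0 : ℝ) 1) :
    ∫ x in (0 : ℝ)..t, g (slopeMap u v e x) =
      leftZero u e * (∫ x in (0 : ℝ)..1, g x)
        + (if t < 1 / 2 then 0 else (1 / u + 1 / v) * ∫ x in (0 : ℝ)..(1 / 2 + e), g x)
        + invSlope u v e t * ∫ x in (0 : ℝ)..(slopeMap u v e t), g x := by
  have l0 := H.leftZero_pos
  have l1 := H.leftZero_lt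
  have r0 := H.lt_rightZero
  have r1 := H.rightZero_lt
  have hgi := intervalIntegrable_of_abs_le hg hC
  have hci := intervalIntegrable_of_abs_le (hg.comp (measurable_slopeMap u v e))
    (fun x => hC (slopeMap u v e x))
  have hadd : ∀ a b c : ℝ, (∫ x in a..b, g (slopeMap u v e x))
      + (∫ x in b..c, g (slopeMap u v e x)) = ∫ x in a..c, g (slopeMap u v e x) :=
    fun a b c => intervalIntegral.integral_add_adjacent_intervals (hci a b) (hci b c)
  have hsub : ∀ a b : ℝ, (∫ x in a..b, g x) = (∫ x in (0 : ℝ)..b, g x) - ∫ x in (0 : ℝ)..a, g x :=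
    fun a b => (intervalIntegral.integral_interval_sub_left (hgi _ _) (hgi _ _)).symm
  set G : ℝ → ℝ := fun t => ∫ x in (0 : ℝ)..t, g x with hG
  have hG0 : G 0 = 0 := by simp [hG]
  have I1 : ∀ t, 0 ≤ t → t ≤ leftZero u e → ∫ x in (0 : ℝ)..t, g (slopeMap u v e x) =
      leftZero u e * (G 1 - G (slopeMap u v e t)) := by
    intro t h0 h1
    rw [H.slopeMap_of_le_leftZero h1, ← hsub, ← smul_eq_mul,
      intervalIntegral.integral_congr (g := fun x => g (1 - (leftZero u e)⁻¹ * x)),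
      intervalIntegral.integral_comp_sub_mul _ (inv_ne_zero l0.ne')]
    · simp [div_eq_inv_mul]
    · intro x hx
      rw [uIcc_of_le h0] at hx
      simp only
      rw [H.slopeMap_of_le_leftZero (hx.2.trans h1), div_eq_inv_mul]
  have I2 : ∀ t, leftZero u e ≤ t → t ≤ 1 / 2 →
      ∫ x in (leftZero u e)..t, g (slopeMap u v e x) = 1 / u * G (slopeMap u v e t) := by
    intro t h0 h1
    rw [H.slopeMap_of_mem_left ⟨h0, h1⟩,
      intervalIntegral.integral_congr (g := fun x => g (u * x - u * leftZero u e)),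
      intervalIntegral.integral_comp_mul_sub _ H.u_pos.ne']
    · simp [hG]
    · intro x hx
      rw [uIcc_of_le h0] at hx
      simp only
      rw [H.slopeMap_of_mem_left ⟨hx.1, hx.2.trans h1⟩]
  have I3 : ∀ t, 1 / 2 ≤ t → t ≤ rightZero v e →
      ∫ x in (1 / 2)..t, g (slopeMap u v e x) =
        1 / v * (G (1 / 2 + e) - G (slopeMap u v e t)) := by
    intro t h0 h1
    have := H.v_mul
    rw [H.slopeMap_of_mem_right ⟨h0, h1⟩, ← hsub, one_div v, ← smul_eq_mul,
      intervalIntegral.integral_congr (g := fun x => g (v * rightZero v e - v * x)),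
      intervalIntegral.integral_comp_sub_mul _ H.v_pos.ne',
      show v * rightZero v e - v * (1 / 2) = 1 / 2 + e by linarith]
    intro x hx
    rw [uIcc_of_le h0] at hx
    simp only
    rw [H.slopeMap_of_mem_right ⟨hx.1, hx.2.trans h1⟩]
  have I4 : ∀ t, rightZero v e ≤ t →
      ∫ x in (rightZero v e)..t, g (slopeMap u v e x) =
        (1 - rightZero v e) * G (slopeMap u v e t) := by
    intro t h0
    have h5 : 1 - rightZero v e ≠ 0 := by linarith
    have key : ∀ x, 1 + (x - 1) / (1 - rightZero v e)
        = (1 - rightZero v e)⁻¹ * x - rightZero v e / (1 - rightZero v e) := by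
      intro x; field_simp; ring
    rw [H.slopeMap_of_rightZero_le h0,
      intervalIntegral.integral_congr
        (g := fun x => g ((1 - rightZero v e)⁻¹ * x - rightZero v e / (1 - rightZero v e))),
      intervalIntegral.integral_comp_mul_sub _ (inv_ne_zero h5), key]
    · simp [hG, div_eq_inv_mul]
    · intro x hx
      rw [uIcc_of_le h0] at hx
      simp only
      rw [H.slopeMap_of_rightZero_le hx.1, key]
  have Wl : slopeMap u v e (leftZero u e) = 0 := by
    rw [H.slopeMap_of_mem_left ⟨le_rfl, l1.le⟩, sub_self]
  have Wr : slopeMap u v e (rightZero v e) = 0 := by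
    rw [H.slopeMap_of_mem_right ⟨r0.le, le_rfl⟩, sub_self]
  have Wh : slopeMap u v e (1 / 2) = 1 / 2 + e := by
    rw [H.slopeMap_of_mem_left ⟨l1.le, le_rfl⟩, ← H.u_mul]; ring
  have J1 := I1 _ l0.le le_rfl
  have J2 := I2 _ l1.le le_rfl
  have J3 := I3 _ r0.le le_rfl
  rw [Wl, hG0] at J1
  rw [Wh] at J2
  rw [Wr, hG0] at J3
  change _ = leftZero u e * G 1 + (if t < 1 / 2 then 0 else (1 / u + 1 / v) * G (1 / 2 + e))
    + invSlope u v e t * G (slopeMap u v e t)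
  by_cases h1 : t < leftZero u e
  · rw [I1 t ht.1 h1.le, invSlope, if_pos h1, if_pos (h1.trans l1)]; ring
  by_cases h2 : t < 1 / 2
  · rw [← hadd 0 (leftZero u e) t, J1, I2 t (not_lt.1 h1) h2.le, invSlope, if_neg h1, if_pos h2,
      if_pos h2]; ring
  by_cases h3 : t < rightZero v e
  · rw [← hadd 0 (1 / 2) t, ← hadd 0 (leftZero u e) (1 / 2), J1, J2, I3 t (not_lt.1 h2) h3.le,
      invSlope, if_neg h1, if_neg h2, if_neg h2, if_pos h3]; ring
  · rw [← hadd 0 (rightZero v e) t, ← hadd 0 (1 / 2) (rightZero v e),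
      ← hadd 0 (leftZero u e) (1 / 2), J1, J2, J3, I4 t (not_lt.1 h3),
      invSlope, if_neg h1, if_neg h2, if_neg h2, if_neg h3]; ring

end Admissible

theorem leftZero_eq {u e : ℝ} (hu : u ≠ 0) : leftZero u e = (u - 1 - 2 * e) / (2 * u) := by
  unfold leftZero; field_simp; ring

theorem one_sub_rightZero_eq {v e : ℝ} (hv : v ≠ 0) :
    1 - rightZero v e = (v - 1 - 2 * e) / (2 * v) := by
  unfold rightZero; field_simp; ring

theorem wMap_eq_slopeMap {s₁ s₂ p q r a : ℝ} (H : Admissible (s₁ + p * a) (s₂ + q * a) (r * a)) :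
    wMap s₁ s₂ p q r a = slopeMap (s₁ + p * a) (s₂ + q * a) (r * a) := by
  ext x
  have hu := H.u_pos.ne'
  have hv := H.v_pos.ne'
  have h1 : leftZero (s₁ + p * a) (r * a)
      = (s₁ - 1 + p * a - 2 * r * a) / (2 * (s₁ + p * a)) := by
    rw [leftZero_eq hu]; ring
  have h2 : 1 - rightZero (s₂ + q * a) (r * a)
      = (s₂ - 1 + q * a - 2 * r * a) / (2 * (s₂ + q * a)) := by
    rw [one_sub_rightZero_eq hv]; ring
  simp only [slopeMap, wMap, h2]
  rw [← leftZero, ← rightZero]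
  split_ifs
  · rw [h1, div_div_eq_mul_div]; ring
  · ring
  · ring
  · rw [div_div_eq_mul_div]; ring

end WMaps

/-! ### Triviality of invariant sets and uniqueness of the acim -/

namespace WMaps

theorem intervalIntegral_eq_leb (f : ℝ → ℝ) : ∫ x in (0 : ℝ)..1, f x = ∫ x, f x ∂leb := by
  rw [intervalIntegral.integral_of_le zero_le_one, leb, integral_Icc_eq_integral_Ioc]

instance : IsFiniteMeasure leb := by
  unfold leb; infer_instance

theorem ae_leb_mem : ∀ᵐ x ∂leb, x ∈ Icc (0 : ℝ) 1 := ae_restrict_mem measurableSet_Icc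

theorem abs_indicator_one_le (S : Set ℝ) (x : ℝ) : |S.indicator (1 : ℝ → ℝ) x| ≤ 1 := by
  by_cases h : x ∈ S <;> simp [h]

theorem intervalIntegral_indicator_one {S : Set ℝ} (hS : MeasurableSet S) {t : ℝ}
    (ht : t ∈ Icc (0 : ℝ) 1) :
    ∫ x in (0 : ℝ)..t, S.indicator (1 : ℝ → ℝ) x = leb.real (S ∩ Iic t) := by
  have h : S ∩ Iic t ∩ Icc 0 1 = S ∩ Icc 0 t := by
    ext x; simp only [mem_inter_iff, mem_Iic, mem_Icc]
    constructor
    · rintro ⟨⟨a, b⟩, c, -⟩; exact ⟨a, c, b⟩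
    · rintro ⟨a, b, c⟩; exact ⟨⟨a, c⟩, b, c.trans ht.2⟩
  rw [intervalIntegral.integral_of_le ht.1, ← integral_Icc_eq_integral_Ioc,
    integral_indicator_one hS, leb, measureReal_restrict_apply (hS.inter measurableSet_Iic), h,
    measureReal_restrict_apply hS]

namespace Admissible

variable {u v e : ℝ}

theorem exists_contraction (H : Admissible u v e) :
    ∃ ρ : ℝ, 0 ≤ ρ ∧ ρ < 1 ∧ ∀ x, |invSlope u v e x| ≤ ρ := by
  have hu := H.left
  have hv := H.right
  have he := H.nonneg
  refine ⟨max (1 / 2) (max (1 / u) (1 / v)), by positivity, ?_, fun x =>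
    H.abs_invSlope_le (le_max_left _ _) ((le_max_left _ _).trans (le_max_right _ _))
      ((le_max_right _ _).trans (le_max_right _ _)) x⟩
  refine max_lt (by norm_num) (max_lt ?_ ?_)
  · rw [div_lt_one H.u_pos]; linarith
  · rw [div_lt_one H.v_pos]; linarith

/-- The primitive of the indicator of an invariant set is linear. -/
theorem measureReal_inter_Iic_of_invariant (H : Admissible u v e) {S : Set ℝ}
    (hS : MeasurableSet S) (hinv : slopeMap u v e ⁻¹' S = S) {t : ℝ} (ht : t ∈ Icc (0 : ℝ) 1) :
    leb.real (S ∩ Iic t) = t * leb.real S := by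
  set g : ℝ → ℝ := S.indicator 1 with hg
  have hgm : Measurable g := measurable_one.indicator hS
  have hcomp : ∀ x, g (slopeMap u v e x) = g x := by
    intro x
    have : slopeMap u v e x ∈ S ↔ x ∈ S := by
      rw [← mem_preimage, hinv]
    by_cases h : x ∈ S <;> simp [hg, this, h]
  -- Subtracting the recursion for the constant function `1` from that for `g` cancels the
  -- `leftZero` term, leaving a homogeneous recursion for `D`.
  set D : ℝ → ℝ := fun t => (∫ x in (0 : ℝ)..t, g x) - t * ∫ x in (0 : ℝ)..1, g x with hD
  have hrec : ∀ t ∈ Icc (0 : ℝ) 1,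
      D t = (if t < 1 / 2 then 0 else (1 / u + 1 / v) * D (1 / 2 + e))
        + invSlope u v e t * D (slopeMap u v e t) := by
    intro t ht
    have h1 := H.integral_comp_slopeMap hgm (abs_indicator_one_le S) ht
    have h2 := H.integral_comp_slopeMap (g := fun _ => 1) measurable_const (C := 1) (by simp) ht
    simp only [hcomp] at h1
    simp only [intervalIntegral.integral_const, smul_eq_mul, mul_one, sub_zero] at h2
    simp only [hD]
    by_cases h : t < 1 / 2
    · simp only [if_pos h] at h1 h2 ⊢
      linear_combination h1 - (∫ x in (0 : ℝ)..1, g x) * h2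
    · simp only [if_neg h] at h1 h2 ⊢
      linear_combination h1 - (∫ x in (0 : ℝ)..1, g x) * h2
  have hD1 : D 1 = 0 := by simp [hD]
  have hθ : 0 < 1 / u + 1 / v := add_pos (one_div_pos.2 H.u_pos) (one_div_pos.2 H.v_pos)
  -- The point `1` is fixed and `D 1 = 0`, so the recursion at `1` isolates the peak term.
  have hDc : D (1 / 2 + e) = 0 := by
    have h := hrec 1 (by simp)
    rw [H.slopeMap_one, hD1, if_neg (by norm_num), mul_zero, add_zero] at h
    exact (mul_eq_zero.1 h.symm).resolve_left hθ.ne'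
  have hrec' : ∀ t ∈ Icc (0 : ℝ) 1, D t = invSlope u v e t * D (slopeMap u v e t) := by
    intro t ht
    have h := hrec t ht
    rwa [hDc, mul_zero, ite_self, zero_add] at h
  obtain ⟨ρ, hρ0, hρ1, hρ⟩ := H.exists_contraction
  have hDb : ∀ t ∈ Icc (0 : ℝ) 1, |D t| ≤ 1 := by
    intro t ht
    have h1 : (0 : ℝ) ≤ leb.real (S ∩ Iic t) := measureReal_nonneg
    have h2 : leb.real (S ∩ Iic t) ≤ leb.real univ := measureReal_mono (subset_univ _)
    have h3 : (0 : ℝ) ≤ leb.real (S ∩ Iic 1) := measureReal_nonneg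
    have h4 : leb.real (S ∩ Iic 1) ≤ leb.real univ := measureReal_mono (subset_univ _)
    have h5 : leb.real univ = 1 := by simp [leb]
    simp only [hD, hg]
    rw [intervalIntegral_indicator_one hS ht, intervalIntegral_indicator_one hS (by simp)]
    rw [abs_le]
    constructor <;> nlinarith [ht.1, ht.2]
  have hpow : ∀ n : ℕ, ∀ t ∈ Icc (0 : ℝ) 1, |D t| ≤ ρ ^ n := by
    intro n
    induction n with
    | zero => simpa using hDb
    | succ n ih =>
      intro t ht
      rw [hrec' t ht, abs_mul, pow_succ']
      exact mul_le_mul (hρ t) (ih _ (H.slopeMap_mem ht)) (abs_nonneg _) hρ0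
  have hDt : D t = 0 := by
    have h := ge_of_tendsto' (tendsto_pow_atTop_nhds_zero_of_lt_one hρ0 hρ1)
      (fun n => hpow n t ht)
    exact abs_nonpos_iff.1 h
  have h1 : leb.real (S ∩ Iic 1) = leb.real S := by
    simp only [leb, measureReal_restrict_apply hS,
      measureReal_restrict_apply (hS.inter measurableSet_Iic)]
    congr 1; ext x; simp only [mem_inter_iff, mem_Iic, mem_Icc]; tauto
  simp only [hD, hg] at hDt
  rw [intervalIntegral_indicator_one hS ht, intervalIntegral_indicator_one hS (by simp), h1] at hDt
  linarith

/-- Linearity of the primitive says that `leb` restricted to `S` is a multiple of `leb`; evaluating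
both on `Sᶜ` gives a vanishing product. -/
theorem leb_eq_zero_or_compl_of_invariant (H : Admissible u v e) {S : Set ℝ}
    (hS : MeasurableSet S) (hinv : slopeMap u v e ⁻¹' S = S) : leb S = 0 ∨ leb Sᶜ = 0 := by
  have h : leb.restrict S = leb S • leb := by
    have : IsFiniteMeasure (leb S • leb) := Measure.smul_finite _ (measure_ne_top _ _)
    refine Measure.ext_of_Iic _ _ fun t => ?_
    rw [Measure.restrict_apply measurableSet_Iic, Measure.smul_apply, smul_eq_mul, inter_comm]
    rcases lt_or_ge t 0 with h0 | h0
    · have h1 : leb (Iic t) = 0 := by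
        rw [leb, Measure.restrict_apply measurableSet_Iic]
        convert measure_empty (μ := volume)
        ext x; simp only [mem_inter_iff, mem_Iic, mem_Icc, mem_empty_iff_false, iff_false]
        intro hx; linarith [hx.1, hx.2.1]
      rw [h1, mul_zero]
      exact measure_mono_null inter_subset_right h1
    rcases le_or_gt t 1 with h1 | h1
    · have h2 : leb (Iic t) = ENNReal.ofReal t := by
        rw [leb, Measure.restrict_apply measurableSet_Iic,
          show Iic t ∩ Icc 0 1 = Icc 0 t by
            ext x; simp only [mem_inter_iff, mem_Iic, mem_Icc]
            constructor
            · rintro ⟨a, b, -⟩; exact ⟨b, a⟩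
            · rintro ⟨a, b⟩; exact ⟨b, a, b.trans h1⟩]
        simp
      rw [h2, ← ENNReal.toReal_eq_toReal_iff' (measure_ne_top _ _) (by finiteness),
        ENNReal.toReal_mul, ENNReal.toReal_ofReal h0, mul_comm]
      exact H.measureReal_inter_Iic_of_invariant hS hinv ⟨h0, h1⟩
    · have h2 : leb (Iic t) = 1 := by
        rw [leb, Measure.restrict_apply measurableSet_Iic,
          inter_eq_right.2 (fun x hx => hx.2.trans h1.le)]
        simp
      rw [h2, mul_one]
      simp only [leb, Measure.restrict_apply hS,
        Measure.restrict_apply (hS.inter measurableSet_Iic)]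
      congr 1; ext x; simp only [mem_inter_iff, mem_Iic, mem_Icc]
      constructor
      · tauto
      · rintro ⟨a, b⟩; exact ⟨⟨a, b.2.trans h1.le⟩, b⟩
  have h2 := congrArg (fun m : Measure ℝ => m Sᶜ) h
  simp only [Measure.restrict_apply hS.compl, compl_inter_self, measure_empty,
    Measure.smul_apply, smul_eq_mul] at h2
  exact mul_eq_zero.1 h2.symm

/-- Any probability measure invariant under a `W`-shaped map and equivalent to Lebesgue measure
is the only absolutely continuous one. -/
theorem eq_of_isACIM (H : Admissible u v e) {μ ν : Measure ℝ} (hμ : IsACIM (slopeMap u v e) μ)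
    (hle : leb ≪ μ) (hν : IsACIM (slopeMap u v e) ν) : ν = μ := by
  obtain ⟨hp, hac, hm⟩ := hμ
  obtain ⟨hp', hac', hm'⟩ := hν
  have hE : Ergodic (slopeMap u v e) μ :=
    { toMeasurePreserving := hm
      aeconst_set := by
        intro S hS hinv
        rw [eventuallyConst_set']
        rcases H.leb_eq_zero_or_compl_of_invariant hS hinv with h | h
        · left; exact ae_eq_empty.2 (hac h)
        · right; exact ae_eq_univ.2 (hac h) }
  exact hE.eq_of_absolutelyContinuous hm' (hac'.trans hle)

end Admissible

/-- A positive function whose integrals against indicators are preserved is the density of the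
only absolutely continuous invariant measure. -/
theorem isInvariantDensity_of_integral {u v e : ℝ} {f : ℝ → ℝ} (hf : Measurable f)
    {C : ℝ} (hC : ∀ x, |f x| ≤ C) (hpos : ∀ x ∈ Icc (0 : ℝ) 1, 0 < f x)
    (hone : ∫ x in (0 : ℝ)..1, f x = 1)
    (hinv : ∀ S : Set ℝ, MeasurableSet S →
      ∫ x in (0 : ℝ)..1, S.indicator 1 (slopeMap u v e x) * f x
        = ∫ x in (0 : ℝ)..1, S.indicator 1 x * f x) :
    IsInvariantDensity (slopeMap u v e) f ∧ leb ≪ densityMeasure f := by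
  have hpos' : ∀ᵐ x ∂leb, 0 < f x := ae_leb_mem.mono hpos
  have hint : Integrable f leb :=
    Integrable.of_bound hf.aestronglyMeasurable C (Eventually.of_forall hC)
  have key : ∀ S : Set ℝ, MeasurableSet S →
      densityMeasure f S = ENNReal.ofReal (∫ x in (0 : ℝ)..1, S.indicator 1 x * f x) := by
    intro S hS
    have h1 : ∀ x, S.indicator 1 x * f x = S.indicator f x := by
      intro x; by_cases h : x ∈ S <;> simp [h]
    simp_rw [h1]
    rw [densityMeasure, withDensity_apply _ hS, intervalIntegral_eq_leb, integral_indicator hS,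
      ofReal_integral_eq_lintegral_ofReal hint.integrableOn
        (ae_restrict_of_ae (hpos'.mono fun _ h => h.le))]
  refine ⟨⟨hf.aemeasurable, hpos'.mono fun _ h => h.le, ⟨?_⟩, ?_, measurable_slopeMap u v e, ?_⟩, ?_⟩
  · rw [key _ MeasurableSet.univ]; simp [hone]
  · exact withDensity_absolutelyContinuous _ _
  · ext S hS
    rw [Measure.map_apply (measurable_slopeMap u v e) hS,
      key _ (measurable_slopeMap u v e hS), key _ hS, ← hinv S hS]
    rfl
  · exact withDensity_absolutelyContinuous' (by fun_prop)
      (hpos'.mono fun x h => by simpa using h)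

/-- Invariant densities agree almost everywhere when the invariant measure is unique. -/
theorem IsInvariantDensity.ae_eq {T f g : ℝ → ℝ} (hf : IsInvariantDensity T f)
    (hg : IsInvariantDensity T g) (huniq : ∀ ν, IsACIM T ν → ν = densityMeasure g) :
    f =ᵐ[leb] g := by
  have h := huniq _ hf.2.2
  have := (withDensity_eq_iff_of_sigmaFinite hf.1.ennreal_ofReal hg.1.ennreal_ofReal).1 h
  filter_upwards [this, hf.2.1, hg.2.1] with x h1 h2 h3
  exact (ENNReal.ofReal_eq_ofReal_iff h2 h3).1 h1

end WMaps

/-! ### An invariant density as a series over the peak orbit -/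

namespace WMaps

/-- The forward orbit of the peak value `1 / 2 + e`. -/
noncomputable def peakOrbit (u v e : ℝ) (n : ℕ) : ℝ := (slopeMap u v e)^[n] (1 / 2 + e)

/-- The reciprocal of the derivative of the `n`-th iterate of the map at the peak value. -/
noncomputable def peakWeight (u v e : ℝ) (n : ℕ) : ℝ :=
  ∏ k ∈ Finset.range n, invSlope u v e (peakOrbit u v e k)

/-- The total weight of the visits of the peak orbit to `[1 / 2, 1]`. -/
noncomputable def rightWeight (u v e : ℝ) : ℝ :=
  ∑' n, if peakOrbit u v e n < 1 / 2 then 0 else peakWeight u v e n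

/-- An unnormalized invariant density of `slopeMap u v e`. -/
noncomputable def rawDensity (u v e x : ℝ) : ℝ :=
  1 - (1 / u + 1 / v) * rightWeight u v e
    + (1 / u + 1 / v) *
      ∑' n, peakWeight u v e n * (Iic (peakOrbit u v e n)).indicator 1 x

theorem peakOrbit_succ (u v e : ℝ) (n : ℕ) :
    peakOrbit u v e (n + 1) = slopeMap u v e (peakOrbit u v e n) :=
  Function.iterate_succ_apply' _ _ _

theorem peakWeight_succ (u v e : ℝ) (n : ℕ) :
    peakWeight u v e (n + 1) = peakWeight u v e n * invSlope u v e (peakOrbit u v e n) :=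
  Finset.prod_range_succ _ _

theorem abs_peakWeight_le {u v e ρ : ℝ} (hρ : ∀ x, |invSlope u v e x| ≤ ρ) (n : ℕ) :
    |peakWeight u v e n| ≤ ρ ^ n := by
  rw [peakWeight, Finset.abs_prod]
  calc _ ≤ ∏ _k ∈ Finset.range n, ρ :=
        Finset.prod_le_prod (fun _ _ => abs_nonneg _) (fun k _ => hρ _)
    _ = ρ ^ n := by simp

theorem abs_peakWeight_mul_le {u v e ρ y : ℝ} (hρ : ∀ x, |invSlope u v e x| ≤ ρ) (n : ℕ)
    (hy : |y| ≤ 1) : |peakWeight u v e n * y| ≤ ρ ^ n := by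
  rw [abs_mul]
  exact (mul_le_of_le_one_right (abs_nonneg _) hy).trans (abs_peakWeight_le hρ n)

theorem abs_ite_peakWeight_le {u v e ρ : ℝ} (hρ : ∀ x, |invSlope u v e x| ≤ ρ) (n : ℕ) :
    |if peakOrbit u v e n < 1 / 2 then 0 else peakWeight u v e n| ≤ ρ ^ n := by
  have h := abs_peakWeight_le hρ n
  split_ifs
  · simpa using (abs_nonneg _).trans h
  · exact h

theorem summable_of_abs_le_pow {ρ : ℝ} (h0 : 0 ≤ ρ) (h1 : ρ < 1) {f : ℕ → ℝ}
    (hf : ∀ n, |f n| ≤ ρ ^ n) : Summable f :=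
  Summable.of_norm_bounded (summable_geometric_of_lt_one h0 h1) hf

theorem abs_tsum_le_of_abs_le_pow {ρ : ℝ} (h0 : 0 ≤ ρ) (h1 : ρ < 1) {f : ℕ → ℝ}
    (hf : ∀ n, |f n| ≤ ρ ^ n) : |∑' n, f n| ≤ (1 - ρ)⁻¹ := by
  rw [← Real.norm_eq_abs]
  exact tsum_of_norm_bounded (hasSum_geometric_of_lt_one h0 h1) hf

namespace Admissible

variable {u v e : ℝ}

theorem peakOrbit_mem (H : Admissible u v e) (n : ℕ) : peakOrbit u v e n ∈ Icc (0 : ℝ) 1 := by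
  induction n with
  | zero => exact H.peak_mem
  | succ n ih => rw [peakOrbit_succ]; exact H.slopeMap_mem ih

theorem sum_inv_pos (H : Admissible u v e) : 0 < 1 / u + 1 / v :=
  add_pos (one_div_pos.2 H.u_pos) (one_div_pos.2 H.v_pos)

theorem abs_rawDensity_le (H : Admissible u v e) {ρ : ℝ} (h0 : 0 ≤ ρ) (h1 : ρ < 1)
    (hρ : ∀ x, |invSlope u v e x| ≤ ρ) (x : ℝ) :
    |rawDensity u v e x| ≤ 1 + 2 * (1 / u + 1 / v) * (1 - ρ)⁻¹ := by
  have hB : |rightWeight u v e| ≤ (1 - ρ)⁻¹ :=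
    abs_tsum_le_of_abs_le_pow h0 h1 (abs_ite_peakWeight_le hρ)
  have hT := abs_tsum_le_of_abs_le_pow h0 h1 (fun n =>
    abs_peakWeight_mul_le hρ n (abs_indicator_one_le (Iic (peakOrbit u v e n)) x))
  have hθ := H.sum_inv_pos
  unfold rawDensity
  rw [abs_le] at hB hT ⊢
  constructor <;> nlinarith [hB.1, hB.2, hT.1, hT.2]

theorem measurable_rawDensity (H : Admissible u v e) : Measurable (rawDensity u v e) := by
  obtain ⟨ρ, h0, h1, hρ⟩ := H.exists_contraction
  unfold rawDensity
  refine measurable_const.add (measurable_const.mul ?_)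
  refine measurable_of_tendsto_metrizable (f := fun N x => ∑ n ∈ Finset.range N,
    peakWeight u v e n * (Iic (peakOrbit u v e n)).indicator 1 x) (fun N => ?_) ?_
  · exact Finset.measurable_sum _ fun n _ =>
      measurable_const.mul (measurable_one.indicator measurableSet_Iic)
  · rw [tendsto_pi_nhds]
    intro x
    exact (summable_of_abs_le_pow h0 h1 (fun n => abs_peakWeight_mul_le hρ n
      (abs_indicator_one_le (Iic (peakOrbit u v e n)) x))).hasSum.tendsto_sum_nat

theorem integral_mul_rawDensity (H : Admissible u v e) {g : ℝ → ℝ} (hg : Measurable g)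
    (hC : ∀ x, |g x| ≤ 1) :
    ∫ x in (0 : ℝ)..1, g x * rawDensity u v e x =
      (1 - (1 / u + 1 / v) * rightWeight u v e) * (∫ x in (0 : ℝ)..1, g x)
        + (1 / u + 1 / v) *
          ∑' n, peakWeight u v e n * ∫ x in (0 : ℝ)..peakOrbit u v e n, g x := by
  obtain ⟨ρ, h0, h1, hρ⟩ := H.exists_contraction
  have hgi := intervalIntegrable_of_abs_le hg hC
  have hind : ∀ n x, (Iic (peakOrbit u v e n)).indicator g x
      = g x * (Iic (peakOrbit u v e n)).indicator 1 x := by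
    intro n x
    by_cases h : x ∈ Iic (peakOrbit u v e n) <;> simp [h]
  have hle : ∀ n x, |peakWeight u v e n * (Iic (peakOrbit u v e n)).indicator g x| ≤ ρ ^ n := by
    intro n x
    refine abs_peakWeight_mul_le hρ n ?_
    rw [hind, abs_mul]
    exact mul_le_one₀ (hC x) (abs_nonneg _) (abs_indicator_one_le _ _)
  have hmeas : ∀ n, Measurable
      fun x => peakWeight u v e n * (Iic (peakOrbit u v e n)).indicator g x :=
    fun n => measurable_const.mul (hg.indicator measurableSet_Iic)
  have hsum : HasSum (fun n => ∫ x in (0 : ℝ)..1,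
      peakWeight u v e n * (Iic (peakOrbit u v e n)).indicator g x)
      (∫ x in (0 : ℝ)..1, ∑' n, peakWeight u v e n * (Iic (peakOrbit u v e n)).indicator g x) := by
    refine intervalIntegral.hasSum_integral_of_dominated_convergence (fun n _ => ρ ^ n)
      (fun n => (hmeas n).aestronglyMeasurable) (fun n => ?_) ?_ ?_ ?_
    · exact Eventually.of_forall fun x _ => hle n x
    · exact Eventually.of_forall fun x _ => summable_geometric_of_lt_one h0 h1
    · exact intervalIntegrable_const
    · exact Eventually.of_forall fun x _ => (summable_of_abs_le_pow h0 h1 (hle · x)).hasSum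
  have hterm : ∀ n, ∫ x in (0 : ℝ)..1,
      peakWeight u v e n * (Iic (peakOrbit u v e n)).indicator g x
        = peakWeight u v e n * ∫ x in (0 : ℝ)..peakOrbit u v e n, g x := by
    intro n
    have hn := H.peakOrbit_mem n
    rw [intervalIntegral.integral_const_mul]
    congr 1
    exact intervalIntegral.integral_indicator hn
  have hexp : ∀ x, g x * rawDensity u v e x =
      (1 - (1 / u + 1 / v) * rightWeight u v e) * g x + (1 / u + 1 / v) *
        ∑' n, peakWeight u v e n * (Iic (peakOrbit u v e n)).indicator g x := by
    intro x
    have : ∑' n, peakWeight u v e n * (Iic (peakOrbit u v e n)).indicator g x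
        = g x * ∑' n, peakWeight u v e n * (Iic (peakOrbit u v e n)).indicator 1 x := by
      rw [← tsum_mul_left]
      exact tsum_congr fun n => by rw [hind]; ring
    rw [this, rawDensity]; ring
  simp_rw [hexp]
  have hmt : Measurable
      fun x => ∑' n, peakWeight u v e n * (Iic (peakOrbit u v e n)).indicator g x := by
    refine measurable_of_tendsto_metrizable (f := fun N x => ∑ n ∈ Finset.range N,
      peakWeight u v e n * (Iic (peakOrbit u v e n)).indicator g x)
      (fun N => Finset.measurable_sum _ fun n _ => hmeas n) ?_
    rw [tendsto_pi_nhds]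
    exact fun x => (summable_of_abs_le_pow h0 h1 (hle · x)).hasSum.tendsto_sum_nat
  have hti := intervalIntegrable_of_abs_le hmt
    (fun x => abs_tsum_le_of_abs_le_pow h0 h1 (hle · x))
  rw [intervalIntegral.integral_add ((hgi 0 1).const_mul _) ((hti 0 1).const_mul _),
    intervalIntegral.integral_const_mul, intervalIntegral.integral_const_mul, ← hsum.tsum_eq]
  simp_rw [hterm]

/-- The constant `1 - θ * rightWeight` in `rawDensity`, with `θ = 1/u + 1/v`, is chosen so that all
peak terms add up to exactly `θ * G c`, the `n = 0` term lost in the index shift. Only a multiple of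
the integral of `g` remains, with a factor independent of `g`. -/
theorem integral_comp_mul_rawDensity_sub (H : Admissible u v e) {g : ℝ → ℝ} (hg : Measurable g)
    (hC : ∀ x, |g x| ≤ 1) :
    ∫ x in (0 : ℝ)..1, g (slopeMap u v e x) * rawDensity u v e x =
      (∫ x in (0 : ℝ)..1, g x * rawDensity u v e x) +
      (∫ x in (0 : ℝ)..1, g x) *
        ((1 - (1 / u + 1 / v) * rightWeight u v e) * (leftZero u e - rightZero v e)
          + (1 / u + 1 / v) * leftZero u e * ∑' n, peakWeight u v e n) := by
  obtain ⟨ρ, h0, h1, hρ⟩ := H.exists_contraction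
  rw [H.integral_mul_rawDensity hg hC,
    H.integral_mul_rawDensity (g := fun x => g (slopeMap u v e x))
      (hg.comp (measurable_slopeMap u v e)) (fun x => hC _),
    H.integral_comp_slopeMap hg hC (by simp : (1 : ℝ) ∈ Icc (0 : ℝ) 1), H.slopeMap_one,
    H.invSlope_one, if_neg (by norm_num)]
  set G : ℝ → ℝ := fun t => ∫ x in (0 : ℝ)..t, g x with hG
  -- The last summand is the next term of the original series: `σ` at the orbit point extends the
  -- weight and `W` advances the orbit.
  have hterm : ∀ n, peakWeight u v e n *
      (∫ x in (0 : ℝ)..peakOrbit u v e n, g (slopeMap u v e x)) =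
      leftZero u e * G 1 * peakWeight u v e n
        + (1 / u + 1 / v) * G (1 / 2 + e) *
          (if peakOrbit u v e n < 1 / 2 then 0 else peakWeight u v e n)
        + peakWeight u v e (n + 1) * G (peakOrbit u v e (n + 1)) := by
    intro n
    rw [H.integral_comp_slopeMap hg hC (H.peakOrbit_mem n), peakWeight_succ, peakOrbit_succ]
    split_ifs <;> simp only [hG] <;> ring
  simp_rw [hterm]
  have hGb : ∀ n, |G (peakOrbit u v e n)| ≤ 1 := by
    intro n
    have hn := H.peakOrbit_mem n
    have := intervalIntegral.norm_integral_le_of_norm_le_const (a := 0) (b := peakOrbit u v e n)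
      (f := g) (C := 1) (fun x _ => hC x)
    rw [sub_zero, abs_of_nonneg hn.1, one_mul] at this
    exact this.trans hn.2
  have s1 : Summable (peakWeight u v e) := summable_of_abs_le_pow h0 h1 (abs_peakWeight_le hρ)
  have s2 := summable_of_abs_le_pow h0 h1 (abs_ite_peakWeight_le hρ)
  have s3 : Summable fun n => peakWeight u v e n * G (peakOrbit u v e n) :=
    summable_of_abs_le_pow h0 h1 (fun n => abs_peakWeight_mul_le hρ n (hGb n))
  rw [((s1.mul_left _).add (s2.mul_left _)).tsum_add ((summable_nat_add_iff 1).2 s3),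
    (s1.mul_left _).tsum_add (s2.mul_left _), tsum_mul_left, tsum_mul_left, s3.tsum_eq_zero_add,
    ← rightWeight]
  have e1 : peakWeight u v e 0 = 1 := by simp [peakWeight]
  have e2 : peakOrbit u v e 0 = 1 / 2 + e := rfl
  rw [e1, e2]
  change (1 - (1 / u + 1 / v) * rightWeight u v e) * (leftZero u e * G 1
    + (1 / u + 1 / v) * G (1 / 2 + e) + (1 - rightZero v e) * G 1) + _ = _
  ring

theorem integral_comp_mul_rawDensity (H : Admissible u v e) {g : ℝ → ℝ} (hg : Measurable g)
    (hC : ∀ x, |g x| ≤ 1) :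
    ∫ x in (0 : ℝ)..1, g (slopeMap u v e x) * rawDensity u v e x =
      ∫ x in (0 : ℝ)..1, g x * rawDensity u v e x := by
  -- For the constant `1` the two integrals coincide trivially, which forces the leftover factor to
  -- vanish.
  have h := H.integral_comp_mul_rawDensity_sub (g := fun _ => 1) measurable_const (by simp)
  have hκ : (1 - (1 / u + 1 / v) * rightWeight u v e) * (leftZero u e - rightZero v e)
      + (1 / u + 1 / v) * leftZero u e * ∑' n, peakWeight u v e n = 0 := by
    simpa using h
  rw [H.integral_comp_mul_rawDensity_sub hg hC, hκ, mul_zero, add_zero]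

/-- A lower bound for the raw density through the weights of all returns of the peak orbit and
of its returns to `[1 / 2, 1]`. -/
theorem min_le_rawDensity (H : Admissible u v e) (x : ℝ) :
    min (1 - (1 / u + 1 / v) - 2 * (1 / u + 1 / v) *
          ∑' n, |if peakOrbit u v e (n + 1) < 1 / 2 then 0 else peakWeight u v e (n + 1)|)
        (1 - (1 / u + 1 / v) - (1 / u + 1 / v) *
          (∑' n, |if peakOrbit u v e (n + 1) < 1 / 2 then 0 else peakWeight u v e (n + 1)|)
          + (1 / u + 1 / v) * (1 - ∑' n, |peakWeight u v e (n + 1)|)) ≤ rawDensity u v e x := by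
  obtain ⟨ρ, h0, h1, hρ⟩ := H.exists_contraction
  have hθ := H.sum_inv_pos
  have e1 : peakWeight u v e 0 = 1 := by simp [peakWeight]
  have e2 : peakOrbit u v e 0 = 1 / 2 + e := rfl
  have s1 : Summable (peakWeight u v e) := summable_of_abs_le_pow h0 h1 (abs_peakWeight_le hρ)
  have s2 := summable_of_abs_le_pow h0 h1 (abs_ite_peakWeight_le hρ)
  have s3 := summable_of_abs_le_pow h0 h1 (fun n =>
    abs_peakWeight_mul_le hρ n (abs_indicator_one_le (Iic (peakOrbit u v e n)) x))
  have s1' := (summable_nat_add_iff 1).2 s1.abs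
  have s2' := (summable_nat_add_iff 1).2 s2.abs
  have s3' := (summable_nat_add_iff 1).2 s3.abs
  have t1 : ∀ f : ℕ → ℝ, Summable (fun n => |f n|) → |∑' n, f n| ≤ ∑' n, |f n| := by
    intro f hf
    simp only [← Real.norm_eq_abs] at hf ⊢
    exact norm_tsum_le_tsum_norm hf
  set θ := 1 / u + 1 / v
  set E := ∑' n, |if peakOrbit u v e (n + 1) < 1 / 2 then 0 else peakWeight u v e (n + 1)|
    with hE
  set S := ∑' n, |peakWeight u v e (n + 1)| with hS
  -- The peak itself lies in the right half and has weight `1`; `E` bounds all later right visits.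
  have hB : rightWeight u v e ≤ 1 + E := by
    rw [rightWeight, s2.tsum_eq_zero_add, e1, e2, if_neg (by linarith [H.nonneg])]
    linarith [(abs_le.1 (t1 _ s2')).2]
  have hT := (abs_le.1 (t1 _ s3')).1
  have hB' := mul_le_mul_of_nonneg_left hB hθ.le
  have hT' := mul_le_mul_of_nonneg_left hT hθ.le
  have hraw : rawDensity u v e x = 1 - θ * rightWeight u v e + θ *
      ((Iic (1 / 2 + e)).indicator 1 x + ∑' n, peakWeight u v e (n + 1) *
        (Iic (peakOrbit u v e (n + 1))).indicator 1 x) := by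
    rw [rawDensity, s3.tsum_eq_zero_add, e1, e2, one_mul]
  rw [hraw]
  -- Below the peak the `n = 0` indicator contributes `1` and the other terms cost at most `S`.
  -- Above it that indicator vanishes, but only orbit points beyond `x > 1/2` contribute, so the
  -- cost is at most `E`.
  by_cases hx : x ≤ 1 / 2 + e
  · refine (min_le_right _ _).trans ?_
    have h3 : ∑' n, |peakWeight u v e (n + 1) *
        (Iic (peakOrbit u v e (n + 1))).indicator 1 x| ≤ S := by
      refine s3'.tsum_le_tsum (fun n => ?_) s1'
      rw [abs_mul]
      exact mul_le_of_le_one_right (abs_nonneg _) (abs_indicator_one_le _ _)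
    have h3' := mul_le_mul_of_nonneg_left h3 hθ.le
    rw [indicator_of_mem (mem_Iic.2 hx), Pi.one_apply]
    linarith
  · refine (min_le_left _ _).trans ?_
    have h3 : ∑' n, |peakWeight u v e (n + 1) *
        (Iic (peakOrbit u v e (n + 1))).indicator 1 x| ≤ E := by
      refine s3'.tsum_le_tsum (fun n => ?_) s2'
      by_cases hn : x ≤ peakOrbit u v e (n + 1)
      · rw [indicator_of_mem (mem_Iic.2 hn), if_neg (by linarith [H.nonneg]), Pi.one_apply, mul_one]
      · rw [indicator_of_notMem (by simpa using hn), mul_zero, abs_zero]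
        exact abs_nonneg _
    have h3' := mul_le_mul_of_nonneg_left h3 hθ.le
    rw [indicator_of_notMem (by simpa using hx)]
    linarith

end Admissible

end WMaps

/-! ### Normalization and the density of the unperturbed map -/

namespace WMaps

/-- The invariant density of `slopeMap u v e` obtained by normalizing `rawDensity`. -/
noncomputable def normDensity (u v e x : ℝ) : ℝ :=
  rawDensity u v e x / ∫ y in (0 : ℝ)..1, rawDensity u v e y

namespace Admissible

variable {u v e : ℝ}

theorem le_integral_rawDensity (H : Admissible u v e) {δ : ℝ}
    (hδ : ∀ x, δ ≤ rawDensity u v e x) : δ ≤ ∫ x in (0 : ℝ)..1, rawDensity u v e x := by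
  obtain ⟨ρ, h0, h1, hρ⟩ := H.exists_contraction
  have h := intervalIntegral.integral_mono_on (a := 0) (b := 1) zero_le_one
    (intervalIntegrable_const (c := δ) (μ := volume))
    (intervalIntegrable_of_abs_le H.measurable_rawDensity (H.abs_rawDensity_le h0 h1 hρ) 0 1)
    (fun x _ => hδ x)
  simpa using h

theorem abs_normDensity_le (H : Admissible u v e) {δ K : ℝ} (hδ0 : 0 < δ)
    (hδ : ∀ x, δ ≤ rawDensity u v e x) (hK : ∀ x, |rawDensity u v e x| ≤ K) (x : ℝ) :
    |normDensity u v e x| ≤ K / δ := by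
  have hZ := H.le_integral_rawDensity hδ
  rw [normDensity, abs_div, abs_of_pos (hδ0.trans_le hZ)]
  exact div_le_div₀ ((abs_nonneg _).trans (hK x)) (hK x) hδ0 hZ

theorem measurable_normDensity (H : Admissible u v e) : Measurable (normDensity u v e) :=
  H.measurable_rawDensity.div_const _

theorem isInvariantDensity_normDensity (H : Admissible u v e) {δ : ℝ} (hδ0 : 0 < δ)
    (hδ : ∀ x, δ ≤ rawDensity u v e x) :
    IsInvariantDensity (slopeMap u v e) (normDensity u v e) ∧
      leb ≪ densityMeasure (normDensity u v e) := by
  obtain ⟨ρ, h0, h1, hρ⟩ := H.exists_contraction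
  have hZ := hδ0.trans_le (H.le_integral_rawDensity hδ)
  refine isInvariantDensity_of_integral H.measurable_normDensity
    (H.abs_normDensity_le hδ0 hδ (H.abs_rawDensity_le h0 h1 hρ))
    (fun x _ => div_pos (hδ0.trans_le (hδ x)) hZ) ?_ (fun S hS => ?_)
  · simp only [normDensity]
    rw [intervalIntegral.integral_div, div_self hZ.ne']
  · simp only [normDensity, ← mul_div_assoc]
    rw [intervalIntegral.integral_div, intervalIntegral.integral_div,
      H.integral_comp_mul_rawDensity (measurable_one.indicator hS) (abs_indicator_one_le S)]

end Admissible

theorem h₀_denom_pos {s₁ s₂ : ℝ} (hs₁ : 1 < s₁) (hs₂ : 1 < s₂) : 0 < 2 * s₁ * s₂ + s₁ - s₂ := by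
  nlinarith

theorem measurable_h₀ (s₁ s₂ : ℝ) : Measurable (h₀ s₁ s₂) := by
  unfold h₀
  exact Measurable.ite measurableSet_Iio (by fun_prop) (by fun_prop)

theorem abs_h₀_le (s₁ s₂ x : ℝ) : |h₀ s₁ s₂ x| ≤
    |2 * s₁ * (s₂ + 1) / (2 * s₁ * s₂ + s₁ - s₂)|
      + |2 * s₂ * (s₁ - 1) / (2 * s₁ * s₂ + s₁ - s₂)| := by
  unfold h₀
  split_ifs
  · exact le_add_of_nonneg_right (abs_nonneg _)
  · exact le_add_of_nonneg_left (abs_nonneg _)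

theorem h₀_pos {s₁ s₂ : ℝ} (hs₁ : 1 < s₁) (hs₂ : 1 < s₂) (x : ℝ) : 0 < h₀ s₁ s₂ x := by
  have hD := h₀_denom_pos hs₁ hs₂
  have h1 : 0 < s₁ - 1 := by linarith
  unfold h₀
  split_ifs <;> positivity

theorem integral_mul_h₀ {s₁ s₂ : ℝ} {g : ℝ → ℝ} (hg : Measurable g) (hC : ∀ x, |g x| ≤ 1) :
    ∫ x in (0 : ℝ)..1, g x * h₀ s₁ s₂ x =
      2 * s₂ * (s₁ - 1) / (2 * s₁ * s₂ + s₁ - s₂) * (∫ x in (0 : ℝ)..1, g x)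
      + (2 * s₁ * (s₂ + 1) / (2 * s₁ * s₂ + s₁ - s₂)
        - 2 * s₂ * (s₁ - 1) / (2 * s₁ * s₂ + s₁ - s₂)) * ∫ x in (0 : ℝ)..(1 / 2), g x := by
  set l := 2 * s₁ * (s₂ + 1) / (2 * s₁ * s₂ + s₁ - s₂)
  set r := 2 * s₂ * (s₁ - 1) / (2 * s₁ * s₂ + s₁ - s₂)
  have hgi := intervalIntegrable_of_abs_le hg hC
  have hii := intervalIntegrable_of_abs_le (g := (Iic (1 / 2 : ℝ)).indicator g)
    (hg.indicator measurableSet_Iic) (C := 1) (fun x => by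
      by_cases h : x ∈ Iic (1 / 2 : ℝ)
      · rw [indicator_of_mem h]; exact hC x
      · rw [indicator_of_notMem h]; simp)
  have hae : ∀ᵐ x : ℝ, x ∈ uIoc (0 : ℝ) 1 → g x * h₀ s₁ s₂ x =
      r * g x + (l - r) * (Iic (1 / 2 : ℝ)).indicator g x := by
    -- `h₀` takes its right-hand value at `1/2`, whereas `Iic (1 / 2)` contains that point; the
    -- mismatch is null.
    have h : ∀ᵐ x : ℝ, x ≠ 1 / 2 := by simp [ae_iff]
    filter_upwards [h] with x hx _
    rcases hx.lt_or_gt with h1 | h1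
    · rw [h₀, if_pos h1, indicator_of_mem (mem_Iic.2 h1.le)]; ring
    · rw [h₀, if_neg h1.le.not_gt, indicator_of_notMem (by simpa using h1)]; ring
  rw [intervalIntegral.integral_congr_ae hae,
    intervalIntegral.integral_add ((hgi 0 1).const_mul _) ((hii 0 1).const_mul _),
    intervalIntegral.integral_const_mul, intervalIntegral.integral_const_mul]
  congr 2
  exact intervalIntegral.integral_indicator (by constructor <;> norm_num)

theorem integral_h₀ {s₁ s₂ : ℝ} (hs₁ : 1 < s₁) (hs₂ : 1 < s₂) :
    ∫ x in (0 : ℝ)..1, h₀ s₁ s₂ x = 1 := by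
  have h := integral_mul_h₀ (s₁ := s₁) (s₂ := s₂) (g := fun _ => 1) measurable_const (by simp)
  have hD := (h₀_denom_pos hs₁ hs₂).ne'
  simp only [one_mul, intervalIntegral.integral_const, smul_eq_mul, mul_one, sub_zero] at h
  rw [h]
  set D := 2 * s₁ * s₂ + s₁ - s₂ with hD'
  field_simp
  rw [hD']
  ring

theorem admissible_zero {s₁ s₂ : ℝ} (hs₁ : 1 < s₁) (hs₂ : 1 < s₂) : Admissible s₁ s₂ 0 :=
  ⟨le_rfl, by norm_num, by linarith, by linarith⟩

/-- Without overshoot `1/2` is fixed, so for a step function with its only jump there the recursion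
at `t = 1` and `t = 1/2` closes up, and invariance is an identity in `s₁`, `s₂`. -/
theorem isInvariantDensity_h₀ {s₁ s₂ : ℝ} (hs₁ : 1 < s₁) (hs₂ : 1 < s₂) :
    IsInvariantDensity (slopeMap s₁ s₂ 0) (h₀ s₁ s₂) ∧ leb ≪ densityMeasure (h₀ s₁ s₂) := by
  have H := admissible_zero hs₁ hs₂
  refine isInvariantDensity_of_integral (measurable_h₀ s₁ s₂) (abs_h₀_le s₁ s₂)
    (fun x _ => h₀_pos hs₁ hs₂ x) (integral_h₀ hs₁ hs₂) (fun S hS => ?_)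
  have hg : Measurable (S.indicator (1 : ℝ → ℝ)) := measurable_one.indicator hS
  have hC := abs_indicator_one_le S
  have hD := (h₀_denom_pos hs₁ hs₂).ne'
  have hu := H.u_pos.ne'
  have hv := H.v_pos.ne'
  have hW : slopeMap s₁ s₂ 0 (1 / 2) = 1 / 2 := by
    rw [H.slopeMap_of_mem_left ⟨H.leftZero_lt.le, le_rfl⟩, ← mul_sub, H.u_mul, add_zero]
  -- By convention `1/2` belongs to the descending branch; its `-1/s₂` cancels the `1/s₂` of the
  -- peak term and leaves the `1/s₁` of the ascending branch.
  have hI : invSlope s₁ s₂ 0 (1 / 2) = - (1 / s₂) := by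
    rw [invSlope, if_neg H.leftZero_lt.not_gt, if_neg (lt_irrefl _), if_pos H.lt_rightZero]
  rw [integral_mul_h₀ hg hC, integral_mul_h₀ (g := fun x => S.indicator 1 (slopeMap s₁ s₂ 0 x))
      (hg.comp (measurable_slopeMap s₁ s₂ 0)) (fun x => hC _),
    H.integral_comp_slopeMap hg hC (by simp : (1 : ℝ) ∈ Icc (0 : ℝ) 1),
    H.integral_comp_slopeMap hg hC (by constructor <;> norm_num : (1 / 2 : ℝ) ∈ Icc (0 : ℝ) 1),
    H.slopeMap_one, H.invSlope_one, hW, hI, if_neg (by norm_num), if_neg (lt_irrefl _), add_zero,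
    one_sub_rightZero_eq hv, leftZero_eq hu]
  field_simp
  ring

/-! ### Uniform bounds and limits under perturbation -/

/-- A family of slopes `u ≥ s₁`, `v ≥ s₂` and overshoots `e > 0` tending to `s₁`, `s₂`, `0`. -/
structure Perturbation {ι : Type*} (F : Filter ι) (s₁ s₂ : ℝ) (u v e : ι → ℝ) : Prop where
  one_lt_left : 1 < s₁
  one_lt_right : 1 < s₂
  sum_inv_lt : 1 / s₁ + 1 / s₂ < 1
  tendsto_left : Tendsto u F (𝓝 s₁)
  tendsto_right : Tendsto v F (𝓝 s₂)
  tendsto_overshoot : Tendsto e F (𝓝 0)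
  eventually_le_left : ∀ᶠ i in F, s₁ ≤ u i
  eventually_le_right : ∀ᶠ i in F, s₂ ≤ v i
  eventually_pos : ∀ᶠ i in F, 0 < e i

/-- The limits of the weights of the peak orbit. -/
noncomputable def limitWeight (s₁ s₂ : ℝ) : ℕ → ℝ
  | 0 => 1
  | n + 1 => -(1 / s₂) * (1 / s₁) ^ n

namespace Perturbation

variable {ι : Type*} {F : Filter ι} {s₁ s₂ : ℝ} {u v e : ι → ℝ}

theorem eventually_admissible (P : Perturbation F s₁ s₂ u v e) :
    ∀ᶠ i in F, Admissible (u i) (v i) (e i) := by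
  have h1 := P.one_lt_left
  have h2 := P.one_lt_right
  filter_upwards [P.eventually_le_left, P.eventually_le_right, P.eventually_pos,
    P.tendsto_overshoot.eventually_lt_const (u := 1 / 2) (by norm_num),
    P.tendsto_overshoot.eventually_lt_const (u := (s₁ - 1) / 2) (by linarith),
    P.tendsto_overshoot.eventually_lt_const (u := (s₂ - 1) / 2) (by linarith)]
    with i a b c d f g
  exact ⟨c.le, d, by linarith, by linarith⟩

theorem tendsto_leftZero (P : Perturbation F s₁ s₂ u v e) :
    Tendsto (fun i => leftZero (u i) (e i)) F (𝓝 (leftZero s₁ 0)) := by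
  have h1 := P.one_lt_left
  unfold leftZero
  exact tendsto_const_nhds.sub
    ((tendsto_const_nhds.add P.tendsto_overshoot).div P.tendsto_left (by linarith))

theorem tendsto_rightZero (P : Perturbation F s₁ s₂ u v e) :
    Tendsto (fun i => rightZero (v i) (e i)) F (𝓝 (rightZero s₂ 0)) := by
  have h1 := P.one_lt_right
  unfold rightZero
  exact tendsto_const_nhds.add
    ((tendsto_const_nhds.add P.tendsto_overshoot).div P.tendsto_right (by linarith))

theorem eventually_peak_lt (P : Perturbation F s₁ s₂ u v e) :
    ∀ᶠ i in F, 1 / 2 + e i < rightZero (v i) (e i) := by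
  have h := (admissible_zero P.one_lt_left P.one_lt_right).lt_rightZero
  have ht : Tendsto (fun i => 1 / 2 + e i) F (𝓝 (1 / 2)) := by
    simpa using tendsto_const_nhds.add P.tendsto_overshoot
  exact ht.eventually_lt P.tendsto_rightZero h

/-- The first image of the peak is exactly `1/2 - e (v - 1)`. The ascending branch moves no point
below this barrier above it, since `u + v ≤ u v`. Convergence to `1/2` keeps the orbit on that
branch for each fixed `n`; nothing is claimed uniformly in `n`. -/
theorem tendsto_peakOrbit_succ (P : Perturbation F s₁ s₂ u v e) (n : ℕ) :
    Tendsto (fun i => peakOrbit (u i) (v i) (e i) (n + 1)) F (𝓝 (1 / 2)) ∧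
      ∀ᶠ i in F, peakOrbit (u i) (v i) (e i) (n + 1) ≤ 1 / 2 - e i * (v i - 1) := by
  induction n with
  | zero =>
    have key : ∀ᶠ i in F, peakOrbit (u i) (v i) (e i) 1 = 1 / 2 - e i * (v i - 1) := by
      filter_upwards [P.eventually_admissible, P.eventually_peak_lt] with i H hi
      change slopeMap (u i) (v i) (e i) (1 / 2 + e i) = _
      rw [H.slopeMap_of_mem_right ⟨by linarith [H.nonneg], hi.le⟩]
      linarith [H.v_mul]
    refine ⟨Tendsto.congr' (key.mono fun _ h => h.symm) ?_, key.mono fun _ h => h.le⟩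
    simpa using tendsto_const_nhds.sub
      (P.tendsto_overshoot.mul (P.tendsto_right.sub_const 1))
  | succ n ih =>
    obtain ⟨ih1, ih2⟩ := ih
    have hl := (admissible_zero P.one_lt_left P.one_lt_right).leftZero_lt
    have key : ∀ᶠ i in F, peakOrbit (u i) (v i) (e i) (n + 2) =
        u i * (peakOrbit (u i) (v i) (e i) (n + 1) - 1 / 2) + (1 / 2 + e i) := by
      filter_upwards [P.eventually_admissible, P.eventually_le_right,
        P.tendsto_leftZero.eventually_lt ih1 hl, ih2] with i H hv h1 h2
      have h3 : 0 ≤ e i * (v i - 1) :=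
        mul_nonneg H.nonneg (by linarith [P.one_lt_right])
      rw [peakOrbit_succ, H.slopeMap_of_mem_left ⟨h1.le, by linarith⟩, ← H.u_mul]
      ring
    constructor
    · refine Tendsto.congr' (key.mono fun _ h => h.symm) ?_
      simpa using (P.tendsto_left.mul (ih1.sub_const (1 / 2))).add
        (tendsto_const_nhds.add P.tendsto_overshoot)
    · filter_upwards [key, P.eventually_admissible, ih2, P.eventually_le_left,
        P.eventually_le_right] with i hk H hi hu hv
      have h1 := P.one_lt_left
      have h2 := P.one_lt_right
      have h3 := P.sum_inv_lt
      have h4 : 1 / u i ≤ 1 / s₁ := one_div_le_one_div_of_le (by linarith) hu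
      have h5 : 1 / v i ≤ 1 / s₂ := one_div_le_one_div_of_le (by linarith) hv
      -- This is `1/u + 1/v ≤ 1` with denominators cleared; multiplied by `e` it is what preserves
      -- the barrier.
      have h6 : v i + u i ≤ u i * v i := by
        have h7 : 1 / u i + 1 / v i ≤ 1 := by linarith
        rw [div_add_div _ _ H.u_pos.ne' H.v_pos.ne',
          div_le_one (mul_pos H.u_pos H.v_pos)] at h7
        linarith
      have h7 := mul_le_mul_of_nonneg_left hi H.u_pos.le
      have h8 := mul_le_mul_of_nonneg_left h6 H.nonneg
      rw [show n + 1 + 1 = n + 2 from rfl, hk]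
      linarith

theorem eventually_peakOrbit_succ_lt (P : Perturbation F s₁ s₂ u v e) (n : ℕ) :
    ∀ᶠ i in F, peakOrbit (u i) (v i) (e i) (n + 1) < 1 / 2 := by
  filter_upwards [(P.tendsto_peakOrbit_succ n).2, P.eventually_pos, P.eventually_le_right]
    with i h1 h2 h3
  have : 0 < e i * (v i - 1) := mul_pos h2 (by linarith [P.one_lt_right])
  linarith

theorem tendsto_peakOrbit (P : Perturbation F s₁ s₂ u v e) (n : ℕ) :
    Tendsto (fun i => peakOrbit (u i) (v i) (e i) n) F (𝓝 (1 / 2)) := by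
  cases n with
  | zero => simpa [peakOrbit] using tendsto_const_nhds.add P.tendsto_overshoot
  | succ n => exact (P.tendsto_peakOrbit_succ n).1

/-- The peak lies on the descending branch and, for small parameters, the following orbit points lie
on the ascending one: one factor `-1/v`, then factors `1/u`. At `e = 0` the orbit would instead stay
at `1/2` with factors `-1/v`, so positive overshoot matters. -/
theorem tendsto_peakWeight (P : Perturbation F s₁ s₂ u v e) (n : ℕ) :
    Tendsto (fun i => peakWeight (u i) (v i) (e i) n) F (𝓝 (limitWeight s₁ s₂ n)) := by
  have h1 := P.one_lt_left
  have h2 := P.one_lt_right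
  have hu : Tendsto (fun i => 1 / u i) F (𝓝 (1 / s₁)) :=
    tendsto_const_nhds.div P.tendsto_left (by linarith)
  have hv : Tendsto (fun i => 1 / v i) F (𝓝 (1 / s₂)) :=
    tendsto_const_nhds.div P.tendsto_right (by linarith)
  have hl := (admissible_zero h1 h2).leftZero_lt
  match n with
  | 0 => simpa [peakWeight, limitWeight] using tendsto_const_nhds
  | n + 1 =>
    induction n with
    | zero =>
      have key : ∀ᶠ i in F, peakWeight (u i) (v i) (e i) 1 = -(1 / v i) := by
        filter_upwards [P.eventually_admissible, P.eventually_peak_lt] with i H hi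
        have h3 := H.nonneg
        have h4 := H.leftZero_lt
        rw [peakWeight, Finset.prod_range_one, peakOrbit, Function.iterate_zero_apply, invSlope,
          if_neg (by linarith), if_neg (by linarith), if_pos hi]
      refine Tendsto.congr' (key.mono fun _ h => h.symm) ?_
      simpa [limitWeight] using hv.neg
    | succ n ih =>
      have key : ∀ᶠ i in F, peakWeight (u i) (v i) (e i) (n + 2) =
          peakWeight (u i) (v i) (e i) (n + 1) * (1 / u i) := by
        filter_upwards [P.tendsto_leftZero.eventually_lt (P.tendsto_peakOrbit_succ n).1 hl,
          P.eventually_peakOrbit_succ_lt n] with i h3 h4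
        rw [peakWeight_succ, invSlope, if_neg h3.not_gt, if_pos h4]
      refine Tendsto.congr' (key.mono fun _ h => h.symm) ?_
      have := ih.mul hu
      simpa only [limitWeight, pow_succ, mul_assoc] using this

theorem exists_contraction (P : Perturbation F s₁ s₂ u v e) :
    ∃ ρ : ℝ, 0 ≤ ρ ∧ ρ < 1 ∧ ∀ᶠ i in F, ∀ x, |invSlope (u i) (v i) (e i) x| ≤ ρ := by
  have h1 := P.one_lt_left
  have h2 := P.one_lt_right
  refine ⟨max (1 / 2) (max (1 / s₁) (1 / s₂)), le_max_of_le_left (by norm_num), ?_, ?_⟩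
  · refine max_lt (by norm_num) (max_lt ?_ ?_)
    · rw [div_lt_one (by linarith)]; exact h1
    · rw [div_lt_one (by linarith)]; exact h2
  · filter_upwards [P.eventually_admissible, P.eventually_le_left, P.eventually_le_right]
      with i H hu hv x
    refine H.abs_invSlope_le (le_max_left _ _) ?_ ?_ x
    · exact (one_div_le_one_div_of_le (by linarith) hu).trans
        ((le_max_left _ _).trans (le_max_right _ _))
    · exact (one_div_le_one_div_of_le (by linarith) hv).trans
        ((le_max_right _ _).trans (le_max_right _ _))

theorem hasSum_limitWeight_succ (P : Perturbation F s₁ s₂ u v e) :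
    HasSum (fun n => limitWeight s₁ s₂ (n + 1)) (-(s₁ / (s₂ * (s₁ - 1)))) := by
  have h1 := P.one_lt_left
  have h2 := P.one_lt_right
  have h := (hasSum_geometric_of_lt_one (r := 1 / s₁) (by positivity)
    (by rw [div_lt_one (by linarith)]; exact h1)).mul_left (-(1 / s₂))
  have h3 : s₁ - 1 ≠ 0 := by linarith
  have h4 : -(1 / s₂) * (1 - 1 / s₁)⁻¹ = -(s₁ / (s₂ * (s₁ - 1))) := by
    rw [show 1 - 1 / s₁ = (s₁ - 1) / s₁ by field_simp, inv_div]
    field_simp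
  rwa [h4] at h

theorem tendsto_tsum_abs_peakWeight (P : Perturbation F s₁ s₂ u v e) :
    Tendsto (fun i => ∑' n, |peakWeight (u i) (v i) (e i) (n + 1)|) F
      (𝓝 (s₁ / (s₂ * (s₁ - 1)))) := by
  obtain ⟨ρ, h0, h1, hρ⟩ := P.exists_contraction
  have h2 := P.one_lt_left
  have h3 := P.one_lt_right
  have habs : ∀ n, |limitWeight s₁ s₂ (n + 1)| = -limitWeight s₁ s₂ (n + 1) := by
    intro n
    have : 0 ≤ 1 / s₂ * (1 / s₁) ^ n := by positivity
    rw [abs_of_nonpos]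
    simp only [limitWeight]; linarith
  have hsum : ∑' n, |limitWeight s₁ s₂ (n + 1)| = s₁ / (s₂ * (s₁ - 1)) := by
    simp_rw [habs]
    rw [P.hasSum_limitWeight_succ.neg.tsum_eq, neg_neg]
  rw [← hsum]
  refine tendsto_tsum_of_dominated_convergence (bound := fun n => ρ ^ (n + 1))
    ((summable_nat_add_iff 1).2 (summable_geometric_of_lt_one h0 h1))
    (fun n => (P.tendsto_peakWeight (n + 1)).abs) ?_
  filter_upwards [hρ] with i hi n
  simpa using abs_peakWeight_le hi (n + 1)

/-- Each term is eventually zero, and the uniform geometric bound controls the late returns about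
which the orbit estimate says nothing. -/
theorem tendsto_tsum_abs_right (P : Perturbation F s₁ s₂ u v e) :
    Tendsto (fun i => ∑' n, |if peakOrbit (u i) (v i) (e i) (n + 1) < 1 / 2 then 0
      else peakWeight (u i) (v i) (e i) (n + 1)|) F (𝓝 0) := by
  obtain ⟨ρ, h0, h1, hρ⟩ := P.exists_contraction
  refine (tendsto_tsum_of_dominated_convergence (g := fun _ => 0) (bound := fun n => ρ ^ (n + 1))
    ((summable_nat_add_iff 1).2 (summable_geometric_of_lt_one h0 h1)) (fun n => ?_) ?_).mono_right
    (by rw [tsum_zero])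
  · refine tendsto_const_nhds.congr' ?_
    filter_upwards [P.eventually_peakOrbit_succ_lt n] with i hi
    rw [if_pos hi, abs_zero]
  filter_upwards [hρ] with i hi n
  simpa using abs_ite_peakWeight_le hi (n + 1)

theorem tendsto_rightWeight (P : Perturbation F s₁ s₂ u v e) :
    Tendsto (fun i => rightWeight (u i) (v i) (e i)) F (𝓝 1) := by
  obtain ⟨ρ, h0, h1, hρ⟩ := P.exists_contraction
  -- The limit is written as a series because only the `n = 0` term survives.
  rw [← tsum_ite_eq (0 : ℕ) (fun _ => (1 : ℝ))]
  refine tendsto_tsum_of_dominated_convergence (bound := fun n => ρ ^ n)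
    (summable_geometric_of_lt_one h0 h1) (fun n => ?_) ?_
  · refine tendsto_const_nhds.congr' ?_
    cases n with
    | zero =>
      filter_upwards [P.eventually_pos] with i hi
      rw [if_pos rfl, if_neg]
      · simp [peakWeight]
      · rw [peakOrbit, Function.iterate_zero_apply]; linarith
    | succ n =>
      filter_upwards [P.eventually_peakOrbit_succ_lt n] with i hi
      rw [if_pos hi, if_neg (Nat.succ_ne_zero n)]
  filter_upwards [hρ] with i hi n
  exact abs_ite_peakWeight_le hi n

theorem tendsto_sum_inv (P : Perturbation F s₁ s₂ u v e) :
    Tendsto (fun i => 1 / u i + 1 / v i) F (𝓝 (1 / s₁ + 1 / s₂)) := by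
  have h1 := P.one_lt_left
  have h2 := P.one_lt_right
  exact (tendsto_const_nhds.div P.tendsto_left (by linarith)).add
    (tendsto_const_nhds.div P.tendsto_right (by linarith))

/-- Both this and `1/s₁ + 1/s₂ < 1` amount to `s₁ + s₂ < s₁ s₂`. -/
theorem ratio_lt_one (P : Perturbation F s₁ s₂ u v e) : s₁ / (s₂ * (s₁ - 1)) < 1 := by
  have h1 := P.one_lt_left
  have h2 := P.one_lt_right
  have h3 := P.sum_inv_lt
  rw [div_add_div _ _ (by linarith) (by linarith), div_lt_one (by nlinarith)] at h3
  rw [div_lt_one (mul_pos (by linarith) (by linarith))]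
  linarith

theorem exists_pos_le_rawDensity (P : Perturbation F s₁ s₂ u v e) :
    ∃ δ > 0, ∀ᶠ i in F, ∀ x, δ ≤ rawDensity (u i) (v i) (e i) x := by
  have hpos : 0 < 1 - (1 / s₁ + 1 / s₂) := by linarith [P.sum_inv_lt]
  have hθ : 0 < 1 / s₁ + 1 / s₂ := (admissible_zero P.one_lt_left P.one_lt_right).sum_inv_pos
  have hr := P.ratio_lt_one
  have t := P.tendsto_sum_inv
  have tE := P.tendsto_tsum_abs_right
  have tS := P.tendsto_tsum_abs_peakWeight
  have t1 := (t.const_sub 1).sub ((t.const_mul 2).mul tE)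
  have t2 := ((t.const_sub 1).sub (t.mul tE)).add (t.mul (tS.const_sub 1))
  have t3 := t1.min t2
  -- Both entries of the minimum in `min_le_rawDensity` have limits at least `1 - (1/s₁ + 1/s₂) >
  -- 0`; half of it leaves room.
  refine ⟨(1 - (1 / s₁ + 1 / s₂)) / 2, by linarith, ?_⟩
  have hlt : (1 - (1 / s₁ + 1 / s₂)) / 2 < min
      (1 - (1 / s₁ + 1 / s₂) - 2 * (1 / s₁ + 1 / s₂) * 0)
      (1 - (1 / s₁ + 1 / s₂) - (1 / s₁ + 1 / s₂) * 0
        + (1 / s₁ + 1 / s₂) * (1 - s₁ / (s₂ * (s₁ - 1)))) := by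
    have := mul_pos hθ (sub_pos.2 hr)
    exact lt_min (by linarith) (by linarith)
  filter_upwards [t3.eventually_const_lt hlt, P.eventually_admissible] with i hi H x
  exact hi.le.trans (H.min_le_rawDensity x)

theorem exists_abs_rawDensity_le (P : Perturbation F s₁ s₂ u v e) :
    ∃ K, ∀ᶠ i in F, ∀ x, |rawDensity (u i) (v i) (e i) x| ≤ K := by
  obtain ⟨ρ, h0, h1, hρ⟩ := P.exists_contraction
  have h4 : 0 < (1 - ρ)⁻¹ := inv_pos.2 (by linarith)
  refine ⟨1 + 2 * 1 * (1 - ρ)⁻¹, ?_⟩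
  filter_upwards [P.eventually_admissible, hρ,
    P.tendsto_sum_inv.eventually_lt_const P.sum_inv_lt] with i H hi hθ x
  refine (H.abs_rawDensity_le h0 h1 hi x).trans ?_
  gcongr

/-- Every orbit point tends to `1/2`, so in the limit all jumps merge there. The factor in front of
`h₀` is fixed by the limit `1 - (1/s₁ + 1/s₂)` on the right half. -/
theorem tendsto_rawDensity (P : Perturbation F s₁ s₂ u v e) {x : ℝ} (hx : x ≠ 1 / 2) :
    Tendsto (fun i => rawDensity (u i) (v i) (e i) x) F
      (𝓝 ((1 - (1 / s₁ + 1 / s₂)) * (2 * s₁ * s₂ + s₁ - s₂) / (2 * s₂ * (s₁ - 1))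
        * h₀ s₁ s₂ x)) := by
  obtain ⟨ρ, h0, h1, hρ⟩ := P.exists_contraction
  have h2 := P.one_lt_left
  have h3 := P.one_lt_right
  have hD := (h₀_denom_pos h2 h3).ne'
  have hs : s₁ - 1 ≠ 0 := by linarith
  have hs1 : s₁ ≠ 0 := by linarith
  have hs2 : s₂ ≠ 0 := by linarith
  have hw : HasSum (limitWeight s₁ s₂) (1 - s₁ / (s₂ * (s₁ - 1))) := by
    rw [← hasSum_nat_add_iff' 1]
    simpa [limitWeight] using P.hasSum_limitWeight_succ
  have hT : Tendsto (fun i => ∑' n, peakWeight (u i) (v i) (e i) n *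
      (Iic (peakOrbit (u i) (v i) (e i) n)).indicator 1 x) F
      (𝓝 (∑' n, limitWeight s₁ s₂ n * (Iic (1 / 2 : ℝ)).indicator 1 x)) := by
    refine tendsto_tsum_of_dominated_convergence (bound := fun n => ρ ^ n)
      (summable_geometric_of_lt_one h0 h1) (fun n => ?_) ?_
    · refine (P.tendsto_peakWeight n).mul (tendsto_const_nhds.congr' ?_)
      rcases hx.lt_or_gt with h | h
      · filter_upwards [(P.tendsto_peakOrbit n).eventually_const_lt h] with i hi
        rw [indicator_of_mem (mem_Iic.2 h.le), indicator_of_mem (mem_Iic.2 hi.le)]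
      · filter_upwards [(P.tendsto_peakOrbit n).eventually_lt_const h] with i hi
        rw [indicator_of_notMem (by simpa using h), indicator_of_notMem (by simpa using hi)]
    · filter_upwards [hρ] with i hi n
      exact abs_peakWeight_mul_le hi n (abs_indicator_one_le _ x)
  rw [tsum_mul_right, hw.tsum_eq] at hT
  have := ((P.tendsto_sum_inv.mul P.tendsto_rightWeight).const_sub 1).add
    (P.tendsto_sum_inv.mul hT)
  have hlim : 1 - (1 / s₁ + 1 / s₂) * 1 + (1 / s₁ + 1 / s₂) *
      ((1 - s₁ / (s₂ * (s₁ - 1))) * (Iic (1 / 2 : ℝ)).indicator 1 x) =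
      (1 - (1 / s₁ + 1 / s₂)) * (2 * s₁ * s₂ + s₁ - s₂) / (2 * s₂ * (s₁ - 1)) * h₀ s₁ s₂ x := by
    rcases hx.lt_or_gt with h | h
    · rw [indicator_of_mem (mem_Iic.2 h.le), h₀, if_pos h, Pi.one_apply]
      generalize 2 * s₁ * s₂ + s₁ - s₂ = D at hD ⊢
      field_simp
      ring
    · rw [indicator_of_notMem (by simpa using h), h₀, if_neg h.le.not_gt]
      generalize 2 * s₁ * s₂ + s₁ - s₂ = D at hD ⊢
      field_simp
      ring
  rwa [hlim] at this

theorem tendsto_integral_rawDensity [F.IsCountablyGenerated] (P : Perturbation F s₁ s₂ u v e) :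
    Tendsto (fun i => ∫ x in (0 : ℝ)..1, rawDensity (u i) (v i) (e i) x) F
      (𝓝 ((1 - (1 / s₁ + 1 / s₂)) * (2 * s₁ * s₂ + s₁ - s₂) / (2 * s₂ * (s₁ - 1)))) := by
  obtain ⟨K, hK⟩ := P.exists_abs_rawDensity_le
  have h : ∀ᵐ x : ℝ, x ≠ 1 / 2 := by simp [ae_iff]
  have := intervalIntegral.tendsto_integral_filter_of_dominated_convergence (a := 0) (b := 1)
    (μ := volume) (l := F) (F := fun i x => rawDensity (u i) (v i) (e i) x) (fun _ => K)
    (P.eventually_admissible.mono fun i H => H.measurable_rawDensity.aestronglyMeasurable)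
    (hK.mono fun i hi => Eventually.of_forall fun x _ => hi x) intervalIntegrable_const
    (h.mono fun x hx _ => P.tendsto_rawDensity hx)
  rwa [intervalIntegral.integral_const_mul, integral_h₀ P.one_lt_left P.one_lt_right,
    mul_one] at this

theorem tendsto_normDensity [F.IsCountablyGenerated] (P : Perturbation F s₁ s₂ u v e) {x : ℝ}
    (hx : x ≠ 1 / 2) :
    Tendsto (fun i => normDensity (u i) (v i) (e i) x) F (𝓝 (h₀ s₁ s₂ x)) := by
  have h2 := P.one_lt_left
  have h3 := P.one_lt_right
  have hD := h₀_denom_pos h2 h3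
  have h4 : 0 < 1 - (1 / s₁ + 1 / s₂) := by linarith [P.sum_inv_lt]
  have h5 : 0 < s₁ - 1 := by linarith
  have hc : 0 < (1 - (1 / s₁ + 1 / s₂)) * (2 * s₁ * s₂ + s₁ - s₂) / (2 * s₂ * (s₁ - 1)) := by
    positivity
  have := (P.tendsto_rawDensity hx).div P.tendsto_integral_rawDensity hc.ne'
  rwa [mul_div_cancel_left₀ _ hc.ne'] at this

theorem tendsto_eLpNorm_normDensity [F.IsCountablyGenerated] (P : Perturbation F s₁ s₂ u v e) :
    Tendsto (fun i => eLpNorm (fun x => normDensity (u i) (v i) (e i) x - h₀ s₁ s₂ x) 1 leb) F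
      (𝓝 0) := by
  obtain ⟨K, hK⟩ := P.exists_abs_rawDensity_le
  obtain ⟨δ, hδ0, hδ⟩ := P.exists_pos_le_rawDensity
  have h : ∀ᵐ x ∂leb, x ≠ 1 / 2 := by
    refine ae_restrict_of_ae ?_
    simp [ae_iff]
  simp_rw [eLpNorm_one_eq_lintegral_enorm]
  have hbound : ∀ x, |h₀ s₁ s₂ x| ≤ _ := abs_h₀_le s₁ s₂
  set M := |2 * s₁ * (s₂ + 1) / (2 * s₁ * s₂ + s₁ - s₂)|
      + |2 * s₂ * (s₁ - 1) / (2 * s₁ * s₂ + s₁ - s₂)|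
  have := tendsto_lintegral_filter_of_dominated_convergence (μ := leb) (l := F)
    (F := fun i x => ‖normDensity (u i) (v i) (e i) x - h₀ s₁ s₂ x‖ₑ) (f := fun _ => 0)
    (fun _ => ENNReal.ofReal (K / δ + M)) ?_ ?_ ?_ ?_
  · simpa using this
  · filter_upwards [P.eventually_admissible] with i H
    exact (H.measurable_normDensity.sub (measurable_h₀ s₁ s₂)).enorm
  · filter_upwards [P.eventually_admissible, hK, hδ] with i H h1 h2
    refine Eventually.of_forall fun x => ?_
    rw [← ofReal_norm]
    refine ENNReal.ofReal_le_ofReal ((norm_sub_le _ _).trans ?_)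
    exact add_le_add (H.abs_normDensity_le hδ0 h2 h1 x) (hbound x)
  · simpa using ENNReal.mul_ne_top ENNReal.ofReal_ne_top (measure_ne_top leb univ)
  · filter_upwards [h] with x hx
    have := ((P.tendsto_normDensity hx).sub_const (h₀ s₁ s₂ x)).enorm
    simpa using this

end Perturbation

end WMaps

/-! ### Weak convergence and the original family -/

namespace WMaps

theorem perturbation_wMap {s₁ s₂ p q r : ℝ} (hs₁ : 1 < s₁) (hs₂ : 1 < s₂)
    (hp : 0 < p) (hq : 0 < q) (hr : 0 < r) (hs : 1 / s₁ + 1 / s₂ < 1) :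
    Perturbation (𝓝[>] (0 : ℝ)) s₁ s₂ (fun a => s₁ + p * a) (fun a => s₂ + q * a)
      (fun a => r * a) where
  one_lt_left := hs₁
  one_lt_right := hs₂
  sum_inv_lt := hs
  tendsto_left := by
    refine tendsto_nhdsWithin_of_tendsto_nhds (Continuous.tendsto' (by fun_prop) _ _ (by simp))
  tendsto_right := by
    refine tendsto_nhdsWithin_of_tendsto_nhds (Continuous.tendsto' (by fun_prop) _ _ (by simp))
  tendsto_overshoot := by
    refine tendsto_nhdsWithin_of_tendsto_nhds (Continuous.tendsto' (by fun_prop) _ _ (by simp))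
  eventually_le_left := by
    filter_upwards [self_mem_nhdsWithin] with a ha
    have := mul_pos hp (mem_Ioi.1 ha); linarith
  eventually_le_right := by
    filter_upwards [self_mem_nhdsWithin] with a ha
    have := mul_pos hq (mem_Ioi.1 ha); linarith
  eventually_pos := by
    filter_upwards [self_mem_nhdsWithin] with a ha
    exact mul_pos hr ha

/-- `L¹` convergence of densities implies weak convergence of the measures. -/
theorem tendsto_integral_densityMeasure {ι : Type*} {F : Filter ι} {f : ι → ℝ → ℝ} {f₀ : ℝ → ℝ}
    (hf : ∀ᶠ i in F, AEMeasurable (f i) leb ∧ (∀ᵐ x ∂leb, 0 ≤ f i x) ∧ Integrable (f i) leb)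
    (hf₀ : AEMeasurable f₀ leb ∧ (∀ᵐ x ∂leb, 0 ≤ f₀ x) ∧ Integrable f₀ leb)
    (hlim : Tendsto (fun i => eLpNorm (fun x => f i x - f₀ x) 1 leb) F (𝓝 0))
    {φ : ℝ → ℝ} (hφ : ContinuousOn φ (Icc (0 : ℝ) 1)) :
    Tendsto (fun i => ∫ x, φ x ∂(densityMeasure (f i))) F
      (𝓝 (∫ x, φ x ∂(densityMeasure f₀))) := by
  obtain ⟨C, hC⟩ := isCompact_Icc.exists_bound_of_continuousOn hφ
  have hφm : AEStronglyMeasurable φ leb := hφ.aestronglyMeasurable measurableSet_Icc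
  have hφC : ∀ᵐ x ∂leb, ‖φ x‖ ≤ C := ae_leb_mem.mono hC
  have key : ∀ g : ℝ → ℝ, AEMeasurable g leb ∧ (∀ᵐ x ∂leb, 0 ≤ g x) ∧ Integrable g leb →
      ∫ x, φ x ∂(densityMeasure g) = ∫ x, φ x * g x ∂leb := by
    rintro g ⟨h1, h2, -⟩
    rw [densityMeasure, integral_withDensity_eq_integral_toReal_smul₀ h1.ennreal_ofReal
      (Eventually.of_forall fun x => ENNReal.ofReal_lt_top)]
    refine integral_congr_ae ?_
    filter_upwards [h2] with x hx
    rw [ENNReal.toReal_ofReal hx, smul_eq_mul, mul_comm]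
  have hint : ∀ g : ℝ → ℝ, Integrable g leb → Integrable (fun x => φ x * g x) leb :=
    fun g hg => hg.bdd_mul hφm hφC
  rw [key f₀ hf₀]
  refine Tendsto.congr' (hf.mono fun i hi => (key _ hi).symm) ?_
  -- Multiplication by `φ` is bounded on `L¹` with constant `C`, so the products converge in `L¹` as
  -- well.
  refine tendsto_integral_of_L1' _ (hint _ hf₀.2.2).aestronglyMeasurable
    (hf.mono fun i hi => hint _ hi.2.2) ?_
  have hub : Tendsto (fun i => ENNReal.ofReal C * eLpNorm (fun x => f i x - f₀ x) 1 leb) F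
      (𝓝 0) := by
    simpa using ENNReal.Tendsto.const_mul hlim (Or.inr ENNReal.ofReal_ne_top)
  refine tendsto_of_tendsto_of_tendsto_of_le_of_le tendsto_const_nhds hub (fun _ => zero_le)
    fun i => ?_
  refine eLpNorm_le_mul_eLpNorm_of_ae_le_mul (hφC.mono fun x hx => ?_) 1
  simp only [Pi.sub_apply]
  rw [← mul_sub, norm_mul]
  exact mul_le_mul_of_nonneg_right hx (norm_nonneg _)

end WMaps

theorem theorem2 (s₁ s₂ p q r : ℝ) (hs₁ : 1 < s₁) (hs₂ : 1 < s₂)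
    (hp : 0 < p) (hq : 0 < q) (hr : 0 < r) (hs : 1 / s₁ + 1 / s₂ < 1) :
    ∃ a₀ : ℝ, 0 < a₀ ∧
      -- for small `a`, `W_a` is a map of `[0,1]` onto itself with exactly one acim
      (∀ a ∈ Ico (0 : ℝ) a₀,
        WMaps.wMap s₁ s₂ p q r a '' Icc (0 : ℝ) 1 = Icc (0 : ℝ) 1 ∧
        ∃! μ : Measure ℝ, WMaps.IsACIM (WMaps.wMap s₁ s₂ p q r a) μ) ∧
      -- the normalized invariant densities are uniformly bounded
      (∃ K : ℝ, ∀ a ∈ Ico (0 : ℝ) a₀, ∀ h : ℝ → ℝ,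
        WMaps.IsInvariantDensity (WMaps.wMap s₁ s₂ p q r a) h →
          ∀ᵐ x ∂WMaps.leb, h x ≤ K) ∧
      -- the density of the acim of `W_0`
      WMaps.IsInvariantDensity (WMaps.wMap s₁ s₂ p q r 0) (WMaps.h₀ s₁ s₂) ∧
      -- convergence of the densities in `L¹` and of the measures in the weak-* sense
      ∀ h : ℝ → ℝ → ℝ,
        (∀ a ∈ Ioo (0 : ℝ) a₀,
          WMaps.IsInvariantDensity (WMaps.wMap s₁ s₂ p q r a) (h a)) →
        Tendsto (fun a => eLpNorm (fun x => h a x - WMaps.h₀ s₁ s₂ x) 1 WMaps.leb)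
          (𝓝[>] (0 : ℝ)) (𝓝 0) ∧
        ∀ φ : ℝ → ℝ, ContinuousOn φ (Icc (0 : ℝ) 1) →
          Tendsto (fun a => ∫ x, φ x ∂(WMaps.densityMeasure (h a)))
            (𝓝[>] (0 : ℝ)) (𝓝 (∫ x, φ x ∂(WMaps.densityMeasure (WMaps.h₀ s₁ s₂)))) := by
  open WMaps in
  have P := perturbation_wMap hs₁ hs₂ hp hq hr hs
  obtain ⟨δ, hδ0, hδ⟩ := P.exists_pos_le_rawDensity
  obtain ⟨K, hK⟩ := P.exists_abs_rawDensity_le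
  obtain ⟨a₀, ha₀, hsub⟩ := mem_nhdsGT_iff_exists_Ioo_subset.1
    ((P.eventually_admissible.and hδ).and hK)
  have ha₀ : 0 < a₀ := ha₀
  set M := |2 * s₁ * (s₂ + 1) / (2 * s₁ * s₂ + s₁ - s₂)|
      + |2 * s₂ * (s₁ - 1) / (2 * s₁ * s₂ + s₁ - s₂)| with hM
  -- The uniform lower bound on `rawDensity` is available only for positive overshoot, so `a = 0` is
  -- served by `h₀`; the common bound is the larger of the two.
  have hex : ∀ a ∈ Ico (0 : ℝ) a₀, ∃ f : ℝ → ℝ,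
      Admissible (s₁ + p * a) (s₂ + q * a) (r * a) ∧
      IsInvariantDensity (wMap s₁ s₂ p q r a) f ∧ leb ≪ densityMeasure f ∧
      (∀ x, |f x| ≤ max (K / δ) M) ∧
      (a = 0 → f = h₀ s₁ s₂) ∧
      (0 < a → f = normDensity (s₁ + p * a) (s₂ + q * a) (r * a)) := by
    rintro a ⟨h0, h1⟩
    rcases h0.eq_or_lt with rfl | h0
    · have H : Admissible (s₁ + p * 0) (s₂ + q * 0) (r * 0) := by
        simpa using admissible_zero hs₁ hs₂
      have hi := isInvariantDensity_h₀ hs₁ hs₂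
      refine ⟨h₀ s₁ s₂, H, ?_, hi.2, fun x => (abs_h₀_le s₁ s₂ x).trans (le_max_right _ _),
        fun _ => rfl, fun h => absurd h (lt_irrefl _)⟩
      rw [wMap_eq_slopeMap H]
      simpa using hi.1
    · obtain ⟨⟨H, h2⟩, h3⟩ := hsub ⟨h0, h1⟩
      have hi := H.isInvariantDensity_normDensity hδ0 h2
      refine ⟨_, H, ?_, hi.2, fun x => (H.abs_normDensity_le hδ0 h2 h3 x).trans (le_max_left _ _),
        fun h => absurd h h0.ne', fun _ => rfl⟩
      rw [wMap_eq_slopeMap H]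
      exact hi.1
  -- Transfers bounds and limits from the constructed densities to arbitrary ones.
  have hae : ∀ a ∈ Ico (0 : ℝ) a₀, ∀ f g : ℝ → ℝ, IsInvariantDensity (wMap s₁ s₂ p q r a) f →
      IsInvariantDensity (wMap s₁ s₂ p q r a) g → f =ᵐ[leb] g := by
    intro a ha f g hf hg
    obtain ⟨k, H, hk, hle, -⟩ := hex a ha
    rw [wMap_eq_slopeMap H] at hf hg hk
    have hu : ∀ ν, IsACIM _ ν → ν = densityMeasure k := fun ν hν => H.eq_of_isACIM hk.2.2 hle hν
    exact (hf.ae_eq hk hu).trans (hg.ae_eq hk hu).symm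
  refine ⟨a₀, ha₀, fun a ha => ?_, ⟨max (K / δ) M, fun a ha h hh => ?_⟩, ?_, fun h hh => ?_⟩
  · obtain ⟨f, H, hf, hle, -⟩ := hex a ha
    rw [wMap_eq_slopeMap H] at hf ⊢
    exact ⟨H.image_slopeMap, densityMeasure f, hf.2.2, fun ν hν => H.eq_of_isACIM hf.2.2 hle hν⟩
  · obtain ⟨f, -, hf, -, hb, -⟩ := hex a ha
    filter_upwards [hae a ha h f hh hf] with x hx
    rw [hx]
    exact (le_abs_self _).trans (hb x)
  · obtain ⟨f, -, hf, -, -, h0, -⟩ := hex 0 ⟨le_rfl, ha₀⟩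
    exact h0 rfl ▸ hf
  · have hev : ∀ᶠ a in 𝓝[>] (0 : ℝ), a ∈ Ioo (0 : ℝ) a₀ := Ioo_mem_nhdsGT ha₀
    have hlim : Tendsto (fun a => eLpNorm (fun x => h a x - h₀ s₁ s₂ x) 1 leb)
        (𝓝[>] (0 : ℝ)) (𝓝 0) := by
      refine P.tendsto_eLpNorm_normDensity.congr' ?_
      filter_upwards [hev] with a ha
      have ha' := Ioo_subset_Ico_self ha
      obtain ⟨f, -, hf, -, -, -, h1⟩ := hex a ha'
      refine eLpNorm_congr_ae ?_
      filter_upwards [hae a ha' f (h a) hf (hh a ha)] with x hx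
      rw [← hx, h1 ha.1]
    refine ⟨hlim, fun φ hφ => tendsto_integral_densityMeasure ?_ ?_ hlim hφ⟩
    · filter_upwards [hev] with a ha
      have ha' := Ioo_subset_Ico_self ha
      obtain ⟨f, -, hf, -, hb, -⟩ := hex a ha'
      refine ⟨(hh a ha).1, (hh a ha).2.1,
        Integrable.of_bound (hh a ha).1.aestronglyMeasurable (max (K / δ) M) ?_⟩
      filter_upwards [hae a ha' (h a) f (hh a ha) hf] with x hx
      rw [hx]
      exact hb x
    · exact ⟨(measurable_h₀ s₁ s₂).aemeasurable,
        Eventually.of_forall fun x => (h₀_pos hs₁ hs₂ x).le,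
        Integrable.of_bound (measurable_h₀ s₁ s₂).aestronglyMeasurable M
          (Eventually.of_forall (abs_h₀_le s₁ s₂))⟩
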